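/- **Setting.** Let $\bar d=(d_k)_{k\ge 0}$ be a bounded sequence of integers $d_k\ge 2$, and let $T=T_{\bar d}$ be the rooted tree in which each vertex of level $k$ has $d_k$ children, labelled $1,\dots,d_k$. A rooted automorphism $g$ of $T$ is written $g=\langle g|_1,\dots,g|_{d_0}\rangle\sigma$, where $\sigma\in\mathcal S_{d_0}$ is its action on the first level and $g|_i$, its section at $i$, is an automorphism of the tree of the shifted sequence $(d_{k+1})_{k\ge0}$; sections $g|_v$ at arbitrary vertices $v$ are defined by iteration. Call $g$ *rooted* if $g|_v$ is trivial for every $v$ other than the root, and *directed* if for every $k\ge 0$ the action of $g|_{1^k}$ on the first level fixes the letter $1$ and $g|_{1^k i}$ is rooted for every $i\neq 1$. A finite group $H$ of directed automorphisms is *saturated* if for every $k\ge0$, every $i\in\{2,\dots,d_k\}$ and $h$ uniform in $H$, conditionally on the action of $h|_{1^k}$ on the first level, the permutation in $\mathcal S_{d_{k+1}}$ by which $h|_{1^k i}$ acts on the first level is uniform in $\mathcal S_{d_{k+1}}$. Let $S$ be a finite non-empty set of rooted automorphisms, let $H$ be a finite saturated group of directed automorphisms, and let $G=\langle S\cup H\rangle$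 (a *saturated directed group*). Let $\mathcal O$ be the $G$-orbit of the leftmost boundary point $1^\infty$ of $T$. Let $\Lambda$ be a non-trivial finite group and $\Lambda\wr_{\mathcal O}G=\big(\bigoplus_{\mathcal O}\Lambda\big)\rtimes G$ the permutational wreath product. For $\lambda\in\Lambda$ let $\delta_\lambda\in\bigoplus_{\mathcal O}\Lambda$ have value $\lambda$ at $1^\infty$ and be trivial elsewhere. The *switch-walk measure* $\mu$ is the law of $\delta_\lambda h s$ with $\lambda\in\Lambda$, $h\in H$, $s\in S$ independent and uniform. Let $X_n=s_1\cdots s_n$ with $s_k$ independent of law $\mu$, and for $\rho\in(0,1)$ let $Y_n^\rho=r_1\cdots r_n$, where, independently for each $k$, $r_k=s_k$ with probability $1-\rho$ and $r_k=s_k'$ with probability $\rho$, the $s'_k$ being independent of law $\mu$ and independent of everything else. $\mathrm H$ denotes Shannon entropy and conditional Shannon entropy. **Theorem 7.3.** The switch-walk random walk on $\Lambda\wr_{\mathcal O}G$ is partially entropy noise sensitive: there is $c>0$ (depending on $\bar d,S,H,\Lambda$ but not on $\rho$) such that for every $\rho\in(0,1)$, $$\mathrm H(Y_n^\rho\mid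 X_n)\ \ge\ c\,\mathrm H(X_n)\qquad\text{for all sufficiently large } n .$$ In particular, let $d_k=2$ for all $k$, let $a$ be the rooted automorphism exchanging the two subtrees of the first level, and let $b=\langle c,a\rangle$, $c=\langle d,a\rangle$, $d=\langle b,1\rangle$. Then $S=\{1,a\}$ and $H=\langle b,c,d\rangle$ satisfy the assumptions above, so that $G$ is the first Grigorchuk group, and the switch-walk random walk on its Bartholdi–Erschler extension $\Lambda\wr_{\mathcal O}G$ is partially entropy noise sensitive. -/

import Mathlib

/-! ## Random walks on groups, noise and entropy -/

section Noise

/-- The convolution `μ * ν` of two probability measures on a discrete group: the law of the product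
`x * y` of independent elements `x` of law `μ` and `y` of law `ν`. -/
noncomputable def convolution {W : Type*} [Group W] (μ ν : PMF W) : PMF W :=
  μ.bind fun x => ν.map fun y => x * y

/-- The law at time `n` of the random walk with step `μ`: the `n`-fold convolution, that is the law
of `s₁ s₂ ⋯ sₙ` with independent `sᵢ` of law `μ`. -/
noncomputable def walkLaw {W : Type*} [Group W] (μ : PMF W) : ℕ → PMF W
  | 0 => PMF.pure 1
  | n + 1 => convolution (walkLaw μ n) μ

/-- The mixture `(1 - ρ) p + ρ q` of two discrete probability measures. -/
noncomputable def mixture {α : Type*} (ρ : unitInterval) (p q : PMF α) : PMF α :=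
  ⟨fun z => ENNReal.ofReal (1 - (ρ : ℝ)) * p z + ENNReal.ofReal (ρ : ℝ) * q z, by
    have h : (∑' z, (ENNReal.ofReal (1 - (ρ : ℝ)) * p z + ENNReal.ofReal (ρ : ℝ) * q z)) = 1 := by
      rw [ENNReal.tsum_add, ENNReal.tsum_mul_left, ENNReal.tsum_mul_left, p.tsum_coe, q.tsum_coe,
        mul_one, mul_one, ← ENNReal.ofReal_add (sub_nonneg.2 ρ.2.2) ρ.2.1]
      simp
    exact h ▸ ENNReal.summable.hasSum⟩

/-- The law of a pair of steps `(s, r)`: the step `s` has law `μ`, and `r` is equal to `s` with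
probability `1 - ρ`, and is an independent new sample of `μ` with probability `ρ`. -/
noncomputable def noisyStep {W : Type*} (μ : PMF W) (ρ : unitInterval) : PMF (W × W) :=
  mixture ρ (μ.map fun s => (s, s)) (μ.bind fun s => μ.map fun s' => (s, s'))

/-- The joint law of `(Xₙ, Yₙ)`, where `Xₙ = s₁ ⋯ sₙ` is the random walk with step `μ` and
`Yₙ = r₁ ⋯ rₙ` is obtained from it by independently resampling each step with probability `ρ`. -/
noncomputable def noisyWalkLaw {W : Type*} [Group W] (μ : PMF W) (ρ : unitInterval) (n : ℕ) :
    PMF (W × W) :=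
  walkLaw (noisyStep μ ρ) n

/-- The Shannon entropy `- ∑ ξ(x) log ξ(x)` of a discrete probability measure (of finite entropy,
which is automatic for finitely supported measures). -/
noncomputable def shannonEntropy {α : Type*} (ξ : PMF α) : ℝ :=
  ∑' x, Real.negMulLog (ξ x).toReal

/-- The conditional entropy `H(Y | X) = ∑ₓ P(X = x) ∑_y - P(Y = y | X = x) log P(Y = y | X = x)`
of a pair `(X, Y)` of joint law `π`. -/
noncomputable def conditionalEntropy {α β : Type*} (π : PMF (α × β)) : ℝ :=
  ∑' x, ((π.map Prod.fst) x).toReal *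
    ∑' y, Real.negMulLog ((π (x, y)).toReal / ((π.map Prod.fst) x).toReal)

/-- Partial entropy noise sensitivity of the random walk with step `μ`: there is `c > 0` such that
for every noise parameter `ρ ∈ (0, 1)`, one has `H(Yₙ | Xₙ) ≥ c H(Xₙ)` for all large `n`. -/
def PartiallyEntropyNoiseSensitive {W : Type*} [Group W] (μ : PMF W) : Prop :=
  ∃ c : ℝ, 0 < c ∧ ∀ ρ : unitInterval, 0 < ρ → ρ < 1 → ∀ᶠ n : ℕ in Filter.atTop,
    c * shannonEntropy (walkLaw μ n) ≤ conditionalEntropy (noisyWalkLaw μ ρ n)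

/-- The uniform probability measure on a finite non-empty type. -/
noncomputable def uniformLaw (α : Type*) [Finite α] [Nonempty α] : PMF α :=
  letI := Fintype.ofFinite α
  PMF.uniformOfFintype α

end Noise

/-! ## Permutational wreath products -/

section Wreath

/-- The direct sum `⨁_X Λ`: the finitely supported functions `X → Λ` under pointwise product. -/
def finSuppFun (Λ X : Type*) [Group Λ] : Subgroup (X → Λ) where
  carrier := {f | (Function.mulSupport f).Finite}
  one_mem' := by simp
  mul_mem' {f g} hf hg := (hf.union hg).subset (Function.mulSupport_mul f g)
  inv_mem' {f} hf := by
    have h : Function.mulSupport f⁻¹ = Function.mulSupport f := Function.mulSupport_inv f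
    change (Function.mulSupport f⁻¹).Finite
    rw [h]
    exact hf

/-- The translation action on finitely supported functions: `(g f)(x) = f(g⁻¹ x)`. -/
instance finSuppFunAction (Λ X G : Type*) [Group Λ] [Group G] [MulAction G X] :
    MulDistribMulAction G (finSuppFun Λ X) where
  smul g f := ⟨fun x => f.1 (g⁻¹ • x), by
    have h : (Function.mulSupport f.1).Finite := f.2
    refine (h.image fun x => g • x).subset fun x hx => ⟨g⁻¹ • x, hx, by simp⟩⟩
  one_smul f := Subtype.ext (funext fun x => by change f.1 ((1 : G)⁻¹ • x) = f.1 x; simp)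
  mul_smul g h f := Subtype.ext (funext fun x => by
    change f.1 ((g * h)⁻¹ • x) = f.1 (h⁻¹ • g⁻¹ • x)
    rw [mul_inv_rev, mul_smul])
  smul_mul _ _ _ := rfl
  smul_one _ := rfl

/-- The permutational wreath product `Λ ≀_X G = (⨁_X Λ) ⋊ G`. -/
abbrev PermWreath (Λ X G : Type*) [Group Λ] [Group G] [MulAction G X] : Type _ :=
  finSuppFun Λ X ⋊[MulDistribMulAction.toMulAut G (finSuppFun Λ X)] G

open Classical in
/-- The function `δ_l` with value `l` at `o` and trivial elsewhere. -/
noncomputable def deltaFun {Λ X : Type*} [Group Λ] (o : X) (l : Λ) : finSuppFun Λ X :=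
  ⟨Pi.mulSingle o l, (Set.finite_singleton o).subset Pi.mulSupport_mulSingle_subset⟩

end Wreath

/-! ## Spherically homogeneous rooted trees and their automorphisms -/

section Tree

/-- The degree sequence of a spherically homogeneous rooted tree: a vertex of level `k` has
`deg k ≥ 2` children. The children of such a vertex are labelled by `Fin (deg k)`, so the paths from
the root to level `n` are the words of length `n`, whose `k`-th letter is in `Fin (deg k)`. -/
structure DegreeSeq where
  deg : ℕ → ℕ
  two_le : ∀ k, 2 ≤ deg k

namespace DegreeSeq

/-- The shifted sequence `(deg 1, deg 2, …)`, which describes the subtrees below the first level. -/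
def shift (d : DegreeSeq) : DegreeSeq := ⟨fun k => d.deg (k + 1), fun k => d.two_le (k + 1)⟩

/-- The `k`-fold shift, which describes the subtrees below level `k`. -/
def shiftN : ℕ → DegreeSeq → DegreeSeq
  | 0, d => d
  | k + 1, d => shiftN k d.shift

/-- The leftmost letter of level `k`. -/
def first (d : DegreeSeq) (k : ℕ) : Fin (d.deg k) :=
  ⟨0, lt_of_lt_of_le Nat.zero_lt_two (d.two_le k)⟩

end DegreeSeq

/-- The boundary of the tree: its infinite rays from the root. -/
abbrev Boundary (d : DegreeSeq) : Type := ∀ k, Fin (d.deg k)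

/-- The leftmost ray `1^∞`. -/
def leftmostRay (d : DegreeSeq) : Boundary d := d.first

/-- The group `Aut(T)` of automorphisms of the rooted tree. As every vertex lies on a ray, an
automorphism is determined by its action on the boundary; the bijections of the boundary that arise
are those for which `g x`, `g y` pass through the same vertex of level `n` exactly when `x`, `y` do,
for each level `n`. -/
def TreeAut (d : DegreeSeq) : Subgroup (Equiv.Perm (Boundary d)) where
  carrier := {g | ∀ (x y : Boundary d) (n : ℕ),
    (∀ k < n, g x k = g y k) ↔ (∀ k < n, x k = y k)}
  one_mem' := fun _ _ _ => Iff.rfl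
  mul_mem' := fun hg hh x y n => (hg _ _ n).trans (hh x y n)
  inv_mem' := fun {g} hg x y n => by
    have h := hg (g.symm x) (g.symm y) n
    rw [g.apply_symm_apply, g.apply_symm_apply] at h
    exact h.symm

namespace TreeAut

variable {d : DegreeSeq}

/-- The ray with first letter `a`, followed by the ray `y` of the subtree below `a`. -/
def cons (a : Fin (d.deg 0)) (y : Boundary d.shift) : Boundary d
  | 0 => a
  | k + 1 => y k

/-- A ray without its first letter. -/
def tail (x : Boundary d) : Boundary d.shift := fun k => x (k + 1)

theorem cons_tail (x : Boundary d) : cons (x 0) (tail x) = x := by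
  funext k; cases k <;> rfl

theorem tail_cons (a : Fin (d.deg 0)) (y : Boundary d.shift) : tail (cons a y) = y := rfl

theorem apply_zero_congr (g : TreeAut d) {x y : Boundary d} (h : x 0 = y 0) :
    g.1 x 0 = g.1 y 0 :=
  (g.2 x y 1).2 (fun k hk => by obtain rfl : k = 0 := by omega
                                exact h) 0 Nat.zero_lt_one

/-- The permutation `σ` of the first level induced by `g = ⟨g|₁, …, g|_{d₀}⟩ σ`. -/
def rootPerm (g : TreeAut d) : Equiv.Perm (Fin (d.deg 0)) where
  toFun a := g.1 (cons a (leftmostRay d.shift)) 0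
  invFun a := g⁻¹.1 (cons a (leftmostRay d.shift)) 0
  left_inv a := by
    refine (apply_zero_congr g⁻¹ (x := cons (g.1 (cons a (leftmostRay d.shift)) 0) _)
      (y := g.1 (cons a (leftmostRay d.shift))) rfl).trans ?_
    exact congrFun (g.1.symm_apply_apply (cons a (leftmostRay d.shift))) 0
  right_inv a := by
    refine (apply_zero_congr g (x := cons (g⁻¹.1 (cons a (leftmostRay d.shift)) 0) _)
      (y := g⁻¹.1 (cons a (leftmostRay d.shift))) rfl).trans ?_
    exact congrFun (g.1.apply_symm_apply (cons a (leftmostRay d.shift))) 0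

theorem apply_cons_zero (g : TreeAut d) (a : Fin (d.deg 0)) (y : Boundary d.shift) :
    g.1 (cons a y) 0 = rootPerm g a :=
  apply_zero_congr g rfl

/-- The section `g|_a` at the first-level vertex `a`, an automorphism of the tree with the shifted
degree sequence: `g (a y) = σ(a) (g|_a y)`. -/
def sect (g : TreeAut d) (a : Fin (d.deg 0)) : TreeAut d.shift :=
  ⟨{  toFun := fun y => tail (g.1 (cons a y))
      invFun := fun y => tail (g⁻¹.1 (cons (rootPerm g a) y))
      left_inv := fun y => by
        change tail (g.1.symm (cons (rootPerm g a) (tail (g.1 (cons a y))))) = y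
        rw [← apply_cons_zero g a y, cons_tail, g.1.symm_apply_apply, tail_cons]
      right_inv := fun y => by
        have h : g⁻¹.1 (cons (rootPerm g a) y) 0 = a := by
          rw [apply_cons_zero]
          exact (rootPerm g).symm_apply_apply a
        have h' : cons a (tail (g⁻¹.1 (cons (rootPerm g a) y))) =
            g.1.symm (cons (rootPerm g a) y) :=
          (congrArg (fun b => cons b (tail (g⁻¹.1 (cons (rootPerm g a) y)))) h.symm).trans
            (cons_tail _)
        change tail (g.1 (cons a (tail (g⁻¹.1 (cons (rootPerm g a) y))))) = y
        rw [h', g.1.apply_symm_apply, tail_cons] },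
   fun x y n => by
    have h := g.2 (cons a x) (cons a y) (n + 1)
    constructor
    · intro H k hk
      refine h.1 (fun j hj => ?_) (k + 1) (by omega)
      cases j with
      | zero => exact apply_zero_congr g rfl
      | succ j => exact H j (by omega)
    · intro H k hk
      refine h.2 (fun j hj => ?_) (k + 1) (by omega)
      cases j with
      | zero => rfl
      | succ j => exact H j (by omega)⟩

/-- An automorphism is rooted if all its sections away from the root are trivial (sections of
trivial automorphisms being trivial, it is enough to look at the first level). -/
def IsRooted (g : TreeAut d) : Prop := ∀ a, sect g a = 1

/-- The section of `g` at the vertex `1^k` of the leftmost ray. -/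
def spineSect : (k : ℕ) → {d : DegreeSeq} → TreeAut d → TreeAut (d.shiftN k)
  | 0, _, g => g
  | k + 1, d, g => spineSect k (sect g (d.first 0))

/-- Directed automorphisms: `h = ⟨h|₁, …, h|_{d₀}⟩ σ` is directed when `σ` fixes `1`, the sections
`h|₂, …, h|_{d₀}` are rooted, and `h|₁` is again directed; that is, the first two conditions hold
for the section of `h` at each vertex `1^k`. -/
def IsDirected (h : TreeAut d) : Prop :=
  ∀ k, rootPerm (spineSect k h) ((d.shiftN k).first 0) = (d.shiftN k).first 0 ∧
    ∀ a, a ≠ (d.shiftN k).first 0 → IsRooted (sect (spineSect k h) a)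

/-- A finite group `H` of directed automorphisms is saturated if for each `k`, each `i ≠ 1` and each
permutation `σ`: for uniform `h ∈ H`, conditionally on `σ` being the permutation of the section
`h|_{1^k}`, the rooted part of `h|_{1^k i}` is uniform in the full symmetric group of `d_{k+1}`
letters. (The conditional law is written with cardinalities; it is void if `σ` does not occur.) -/
def IsSaturated (H : Subgroup (TreeAut d)) : Prop :=
  ∀ (k : ℕ) (i : Fin ((d.shiftN k).deg 0)), i ≠ (d.shiftN k).first 0 →
    ∀ (σ : Equiv.Perm (Fin ((d.shiftN k).deg 0)))
      (τ : Equiv.Perm (Fin ((d.shiftN k).shift.deg 0))),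
      Nat.card {h : H // rootPerm (spineSect k h.1) = σ ∧
          rootPerm (sect (spineSect k h.1) i) = τ} *
        Nat.card (Equiv.Perm (Fin ((d.shiftN k).shift.deg 0))) =
      Nat.card {h : H // rootPerm (spineSect k h.1) = σ}

end TreeAut

end Tree

/-! ## Directed groups and the switch-walk measure -/

section Directed

variable {d : DegreeSeq}

/-- The group `G(S, H)` of tree automorphisms generated by `S ∪ H`. -/
def directedGroup (S : Set (TreeAut d)) (H : Subgroup (TreeAut d)) : Subgroup (TreeAut d) :=
  Subgroup.closure (S ∪ H)

/-- `G(S, H)` is a saturated directed group: `S` is a finite non-empty set of rooted automorphisms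
and `H` is a finite, saturated group of directed automorphisms. (Finiteness of `S` and `H` and
non-emptiness of `S` are carried by type classes, where this is used.) -/
structure IsSaturatedDirectedPair (S : Set (TreeAut d)) (H : Subgroup (TreeAut d)) : Prop where
  rooted : ∀ s ∈ S, TreeAut.IsRooted s
  directed : ∀ h ∈ H, TreeAut.IsDirected h
  saturated : TreeAut.IsSaturated H

/-- The orbit of the leftmost ray `1^∞` under `G(S, H)`. -/
abbrev leftmostOrbit (S : Set (TreeAut d)) (H : Subgroup (TreeAut d)) : Type :=
  MulAction.orbit (directedGroup S H) (leftmostRay d)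

/-- The permutational wreath product of `Λ` and `G(S, H)` over the orbit of `1^∞`. -/
abbrev DirectedWreath (Λ : Type*) [Group Λ] (S : Set (TreeAut d)) (H : Subgroup (TreeAut d)) :
    Type _ :=
  PermWreath Λ (leftmostOrbit S H) (directedGroup S H)

/-- The switch-walk measure: the law of `δ_l h s`, where `l ∈ Λ`, `h ∈ H` and `s ∈ S` are
independent and uniform, and `δ_l` sits over the point `1^∞`. -/
noncomputable def switchWalk (Λ : Type*) [Group Λ] [Finite Λ]
    (S : Set (TreeAut d)) [Finite S] [Nonempty S] (H : Subgroup (TreeAut d)) [Finite H] :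
    PMF (DirectedWreath Λ S H) :=
  convolution
    (convolution
      ((uniformLaw Λ).map fun l => SemidirectProduct.inl
        (deltaFun (⟨leftmostRay d, MulAction.mem_orbit_self _⟩ : leftmostOrbit S H) l))
      ((uniformLaw H).map fun h => SemidirectProduct.inr
        (⟨h.1, Subgroup.subset_closure (Or.inr h.2)⟩ : directedGroup S H)))
    ((uniformLaw S).map fun s => SemidirectProduct.inr
      (⟨s.1, Subgroup.subset_closure (Or.inl s.2)⟩ : directedGroup S H))

end Directed

/-! ## The first Grigorchuk group -/

namespace Grigorchuk

/-- The degree sequence of the binary rooted tree. -/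
def binary : DegreeSeq := ⟨fun _ => 2, fun _ => le_rfl⟩

/-- An involution of the boundary under which prefixes determine the prefixes of the images is a
tree automorphism. -/
def ofInvolution (f : Boundary binary → Boundary binary) (hf : Function.Involutive f)
    (hp : ∀ x y n, (∀ k < n, x k = y k) → ∀ k < n, f x k = f y k) : TreeAut binary :=
  ⟨hf.toPerm f, fun x y n => ⟨fun h => by
    have := hp (f x) (f y) n h
    rwa [hf x, hf y] at this, hp x y n⟩⟩

/-- The rooted automorphism `a`, which exchanges the two subtrees below the root. -/
def a : TreeAut binary :=
  ofInvolution (fun x k => if k = 0 then (x k).rev else x k)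
    (fun x => by funext k; by_cases h : k = 0 <;> simp [h])
    (fun x y n h k hk => by simp only [h k hk])

/-- The position `k` of a ray comes just after its first letter other than the leftmost one. -/
def AfterFirst (x : Boundary binary) : ℕ → Prop
  | 0 => False
  | k + 1 => (∀ j < k, x j = binary.first j) ∧ x k ≠ binary.first k

open Classical in
/-- For a ray that starts with `1^k 2`, change the next letter if `e k` is true. -/
noncomputable def flip (e : ℕ → Bool) (x : Boundary binary) : Boundary binary
  | 0 => x 0
  | k + 1 => if AfterFirst x (k + 1) ∧ e k = true then (x (k + 1)).rev else x (k + 1)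

theorem afterFirst_congr {x y : Boundary binary} {k : ℕ} (h : ∀ j < k, x j = y j) :
    AfterFirst x k ↔ AfterFirst y k := by
  cases k with
  | zero => exact Iff.rfl
  | succ k =>
    simp only [AfterFirst]
    rw [h k (by omega)]
    exact and_congr_left fun _ => forall_congr' fun j => imp_congr_right fun hj => by
      rw [h j (by omega)]

theorem flip_eq_of_forall_first (e : ℕ → Bool) (x : Boundary binary) (k : ℕ)
    (h : ∀ j < k, x j = binary.first j) : flip e x k = x k := by
  cases k with
  | zero => rfl
  | succ k => exact if_neg fun H => H.1.2 (h k (by omega))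

theorem afterFirst_flip (e : ℕ → Bool) (x : Boundary binary) (k : ℕ) :
    AfterFirst (flip e x) k ↔ AfterFirst x k := by
  have key : ∀ m, (∀ j < m, flip e x j = binary.first j) ↔ ∀ j < m, x j = binary.first j := by
    intro m
    induction m with
    | zero => simp
    | succ m ih =>
      simp only [Nat.forall_lt_succ_right]
      rw [ih]
      exact and_congr_right fun H => by rw [flip_eq_of_forall_first e x m H]
  cases k with
  | zero => exact Iff.rfl
  | succ k =>
    simp only [AfterFirst]
    rw [key]
    exact and_congr_right fun H => by rw [flip_eq_of_forall_first e x k H]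

theorem flip_flip (e e' : ℕ → Bool) (x : Boundary binary) :
    flip e (flip e' x) = flip (fun k => xor (e k) (e' k)) x := by
  funext k
  cases k with
  | zero => rfl
  | succ k =>
    have h := afterFirst_flip e' x (k + 1)
    by_cases hx : AfterFirst x (k + 1)
    · have h' := h.2 hx
      cases he : e k <;> cases he' : e' k <;> simp [flip, hx, h', he, he']
    · have h' : ¬AfterFirst (flip e' x) (k + 1) := fun H => hx (h.1 H)
      simp only [flip, hx, h', false_and, if_false]

theorem flip_false (x : Boundary binary) : flip (fun _ => false) x = x := by
  funext k
  cases k with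
  | zero => rfl
  | succ k => simp [flip]

/-- The directed automorphism of the binary tree with spine sections `h|_{1^k 2} = a` when `e k` is
true, and trivial otherwise. -/
noncomputable def directedFlip (e : ℕ → Bool) : TreeAut binary :=
  ofInvolution (flip e)
    (fun x => by rw [flip_flip]; simp only [Bool.xor_self]; exact flip_false x)
    (fun x y n h k hk => by
      cases k with
      | zero => exact h 0 hk
      | succ k =>
        have hA := afterFirst_congr (x := x) (y := y) (k := k + 1) fun j hj => h j (by omega)
        have hB : (AfterFirst x (k + 1) ∧ e k = true) ↔ (AfterFirst y (k + 1) ∧ e k = true) :=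
          and_congr_left fun _ => hA
        by_cases hy : AfterFirst y (k + 1) ∧ e k = true
        · exact (if_pos (hB.2 hy)).trans
            ((congrArg Fin.rev (h (k + 1) hk)).trans (if_pos hy).symm)
        · exact (if_neg fun H => hy (hB.1 H)).trans ((h (k + 1) hk).trans (if_neg hy).symm))

/-- `b = ⟨c, a⟩`. -/
noncomputable def b : TreeAut binary := directedFlip fun k => k % 3 != 2

/-- `c = ⟨d, a⟩`. -/
noncomputable def c : TreeAut binary := directedFlip fun k => k % 3 != 1

/-- `d = ⟨b, 1⟩`. -/
noncomputable def d : TreeAut binary := directedFlip fun k => k % 3 != 0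

theorem directedFlip_mul (e e' : ℕ → Bool) :
    directedFlip e * directedFlip e' = directedFlip fun k => xor (e k) (e' k) :=
  Subtype.ext (Equiv.ext fun x => flip_flip e e' x)

/-- The rooted part `⟨a⟩ = {1, a}` of the first Grigorchuk group. -/
def rootedPart : Set (TreeAut binary) := {1, a}

/-- The directed part `⟨b, c, d⟩ = {1, b, c, d}` of the first Grigorchuk group. -/
noncomputable def directedPart : Subgroup (TreeAut binary) := Subgroup.closure {b, c, d}

instance : Finite rootedPart := Set.toFinite ({1, a} : Set (TreeAut binary))

instance : Nonempty rootedPart := ⟨1, Or.inl rfl⟩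

theorem directedFlip_false : directedFlip (fun _ => false) = 1 :=
  Subtype.ext (Equiv.ext fun x => flip_false x)

theorem directedPart_le : (directedPart : Set (TreeAut binary)) ⊆
    Set.range fun p : Bool × Bool × Bool => directedFlip fun k =>
      if k % 3 = 0 then p.1 else if k % 3 = 1 then p.2.1 else p.2.2 := by
  intro g hg
  refine Subgroup.closure_induction (p := fun g _ => g ∈ Set.range fun p : Bool × Bool × Bool =>
    directedFlip fun k => if k % 3 = 0 then p.1 else if k % 3 = 1 then p.2.1 else p.2.2)
    ?_ ?_ ?_ ?_ hg
  · have h3 : ∀ k : ℕ, k % 3 = 0 ∨ k % 3 = 1 ∨ k % 3 = 2 := fun k => by omega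
    rintro g (rfl | rfl | rfl)
    · refine ⟨(true, true, false), congrArg directedFlip (funext fun k => ?_)⟩
      rcases h3 k with h | h | h <;> simp [h]
    · refine ⟨(true, false, true), congrArg directedFlip (funext fun k => ?_)⟩
      rcases h3 k with h | h | h <;> simp [h]
    · refine ⟨(false, true, true), congrArg directedFlip (funext fun k => ?_)⟩
      rcases h3 k with h | h | h <;> simp [h]
  · exact ⟨(false, false, false), by simpa using directedFlip_false⟩
  · rintro _ _ _ _ ⟨p, rfl⟩ ⟨q, rfl⟩
    refine ⟨(xor p.1 q.1, xor p.2.1 q.2.1, xor p.2.2 q.2.2), ?_⟩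
    rw [directedFlip_mul]
    refine congrArg directedFlip (funext fun k => ?_)
    split_ifs <;> rfl
  · rintro _ _ ⟨p, rfl⟩
    exact ⟨p, by
      rw [eq_inv_iff_mul_eq_one, directedFlip_mul]
      simpa using directedFlip_false⟩

instance : Finite directedPart := ((Set.finite_range _).subset directedPart_le).to_subtype

end Grigorchuk

/-! A product of letters `δ_l h s` switches lamps along the inverted orbit `o, g₁ o, g₁ g₂ o, …` of
`o = 1^∞`, where `gᵢ = h s` is the group part of the `i`-th letter. Both entropies are compared with
the mean number of distinct points of this inverted orbit.

Lower bound. Reveal the letters of `Xₙ`, the resampling times and the group parts of the resampled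
letters. This determines `Xₙ` and leaves only the fresh lamps random in `Yₙ`. At the points that the
inverted orbit of `Yₙ` visits at a resampled time the lamps are then independent and uniform, so
`H(Yₙ | Xₙ)` is at least `log |Λ|` times the mean number of such points
(`resampled_le_conditionalEntropy`).

Half of the points are resampled. When letters are added on the left of a word, a visited point
moves along the orbital chain `x ↦ g x`, and each of its returns to `o` is an occasion to be
resampled, with probability `ρ`. If the chain is recurrent at `o`, old points are almost surely
resampled in the long run. The probability that a new letter creates a new point is nonincreasing,
so recent points are a small proportion of all points (`half_meanVisited_le`). The noise `ρ` affects
only how large `n` must be, which is why `c` does not depend on it.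

Upper bound. `H(Xₙ)` is at most linear in the mean number of visited points
(`exists_shannonEntropy_le`). The section of a word over a first-level vertex is a word of the same
kind for the shifted tree, and the visited points are distributed among the vertices. Iterating, an
element reached with `r` visited points is described by a rooted tree of nested sections with at
most `2 r - 1` internal nodes, each carrying boundedly much information. A generating function for
these descriptions is a weight of bounded total mass that gives the element mass at least `z ^ (2 r
- 1)`, and Gibbs' inequality concludes.

Recurrence (`exists_escapeProb_le`). On the finite level `j` the uniform measure is stationary, so
the chain returns to the vertex `1^j`. By saturation, the letter below an exit from the spine is
refreshed uniformly before the chain can come back to the spine, so the law of the first point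
reached below `1^j` is explicit. Starting from `o` it differs from `o` with probability at most `(1
- 1/D)^j`. Letting `j` grow gives recurrence. -/

/-! ## Expectations over words of independent letters -/

section PathSum

variable {A : Type*} [Fintype A] (p : A → ℝ)

/-- The expectation of `f` over words of `n` independent letters of law `p`. -/
noncomputable def pathSum : ℕ → (List A → ℝ) → ℝ
  | 0, f => f []
  | n + 1, f => ∑ a, p a * pathSum n fun l => f (a :: l)

theorem pathSum_add (n : ℕ) (f g : List A → ℝ) :
    pathSum p n (fun l => f l + g l) = pathSum p n f + pathSum p n g := by
  induction n generalizing f g with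
  | zero => rfl
  | succ n ih => simp only [pathSum, ih, mul_add, Finset.sum_add_distrib]

theorem pathSum_const_mul (n : ℕ) (c : ℝ) (f : List A → ℝ) :
    pathSum p n (fun l => c * f l) = c * pathSum p n f := by
  induction n generalizing f with
  | zero => rfl
  | succ n ih =>
    simp only [pathSum, ih, Finset.mul_sum]
    exact Finset.sum_congr rfl fun a _ => by ring

theorem pathSum_sub (n : ℕ) (f g : List A → ℝ) :
    pathSum p n (fun l => f l - g l) = pathSum p n f - pathSum p n g := by
  have h := pathSum_add p n f fun l => -1 * g l
  rw [pathSum_const_mul] at h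
  simpa [sub_eq_add_neg] using h

theorem pathSum_zero (n : ℕ) : pathSum p n (fun _ => 0) = 0 := by
  simpa using pathSum_const_mul p n 0 fun _ => 0

theorem pathSum_sum {ι : Type*} (s : Finset ι) (n : ℕ) (f : ι → List A → ℝ) :
    pathSum p n (fun l => ∑ i ∈ s, f i l) = ∑ i ∈ s, pathSum p n (f i) := by
  classical
  induction s using Finset.induction_on with
  | empty => simpa using pathSum_zero p n
  | insert i s hi ih =>
    simp only [Finset.sum_insert hi, pathSum_add, ih]

theorem pathSum_const (hp : ∑ a, p a = 1) (n : ℕ) (c : ℝ) : pathSum p n (fun _ => c) = c := by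
  induction n with
  | zero => rfl
  | succ n ih => simp only [pathSum, ih, ← Finset.sum_mul, hp, one_mul]

theorem pathSum_mono {p : A → ℝ} (hp : ∀ a, 0 ≤ p a) (n : ℕ) {f g : List A → ℝ}
    (h : ∀ l, l.length = n → f l ≤ g l) : pathSum p n f ≤ pathSum p n g := by
  induction n generalizing f g with
  | zero => exact h [] rfl
  | succ n ih =>
    exact Finset.sum_le_sum fun a _ => mul_le_mul_of_nonneg_left
      (ih fun l hl => h (a :: l) (by simp [hl])) (hp a)

theorem pathSum_congr {n : ℕ} {f g : List A → ℝ}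
    (h : ∀ l, l.length = n → f l = g l) : pathSum p n f = pathSum p n g := by
  induction n generalizing f g with
  | zero => exact h [] rfl
  | succ n ih =>
    exact Finset.sum_congr rfl fun a _ => congrArg _ (ih fun l hl => h (a :: l) (by simp [hl]))

theorem pathSum_nonneg {p : A → ℝ} (hp : ∀ a, 0 ≤ p a) (n : ℕ) {f : List A → ℝ}
    (h : ∀ l, 0 ≤ f l) : 0 ≤ pathSum p n f := by
  have := pathSum_mono hp n (f := fun _ => 0) fun l _ => h l
  rwa [pathSum_zero] at this

/-- The expectation of a function of the letterwise image of a word. -/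
theorem pathSum_map {B : Type*} [Fintype B] (q : B → ℝ) (m : A → B)
    (h : ∀ F : B → ℝ, ∑ a, p a * F (m a) = ∑ b, q b * F b) (n : ℕ) (f : List B → ℝ) :
    pathSum p n (fun l => f (l.map m)) = pathSum q n f := by
  induction n generalizing f with
  | zero => rfl
  | succ n ih =>
    simp only [pathSum, List.map_cons]
    rw [← h fun b => pathSum q n fun l => f (b :: l)]
    exact Finset.sum_congr rfl fun a _ => congrArg _ (ih fun l => f (m a :: l))

theorem pathSum_eq_sum (n : ℕ) (f : List A → ℝ) :
    pathSum p n f = ∑ ω : Fin n → A, (∏ i, p (ω i)) * f (List.ofFn ω) := by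
  induction n generalizing f with
  | zero => simp [pathSum]
  | succ n ih =>
    rw [← (Fin.consEquiv fun _ => A).sum_comp, Fintype.sum_prod_type]
    refine Finset.sum_congr rfl fun a _ => ?_
    rw [ih, Finset.mul_sum]
    refine Finset.sum_congr rfl fun ω _ => ?_
    simp [Fin.consEquiv, Fin.prod_univ_succ, List.ofFn_succ, mul_assoc]

end PathSum

/-! ## Visited points and resampled points -/

section Renewal

open scoped Classical

variable {Γ G X : Type*} [Group G] [MulAction G X] (γ : Γ → G) (o : X) (p : Γ → ℝ)

/-- The points `g₁ ⋯ gᵢ o`, `0 ≤ i < n`, of the inverted orbit of `o` along a word `g₁, …, gₙ`. -/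
noncomputable def visited : List Γ → Finset X
  | [] => ∅
  | c :: l => insert o ((visited l).image fun x => γ c • x)

/-- The points of the inverted orbit that are visited at a marked time. -/
noncomputable def resampled : List (Bool × Γ) → Finset X
  | [] => ∅
  | (ε, c) :: l =>
    if ε then insert o ((resampled l).image fun x => γ c • x)
    else (resampled l).image fun x => γ c • x

theorem mem_image_smul {s : Finset X} {g : G} {x : X} :
    x ∈ s.image (fun x => g • x) ↔ g⁻¹ • x ∈ s := by
  rw [Finset.mem_image]
  constructor
  · rintro ⟨y, hy, rfl⟩
    rwa [inv_smul_smul]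
  · exact fun h => ⟨_, h, smul_inv_smul g x⟩

theorem mem_visited_cons {c : Γ} {l : List Γ} {x : X} :
    x ∈ visited γ o (c :: l) ↔ x = o ∨ (γ c)⁻¹ • x ∈ visited γ o l := by
  rw [visited, Finset.mem_insert, mem_image_smul]

theorem mem_resampled_cons {e : Bool × Γ} {l : List (Bool × Γ)} {x : X} :
    x ∈ resampled γ o (e :: l) ↔
      (e.1 = true ∧ x = o) ∨ (γ e.2)⁻¹ • x ∈ resampled γ o l := by
  obtain ⟨ε, c⟩ := e
  cases ε <;> simp [resampled, mem_image_smul, -Finset.mem_image]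

theorem resampled_subset (l : List (Bool × Γ)) :
    resampled γ o l ⊆ visited γ o (l.map Prod.snd) := by
  induction l with
  | nil => exact fun _ h => h
  | cons e l ih =>
    intro x hx
    rw [mem_resampled_cons] at hx
    rw [List.map_cons, mem_visited_cons]
    exact hx.imp (fun h => h.2) fun h => ih h

theorem card_visited_cons (c : Γ) (l : List Γ) :
    ((visited γ o (c :: l)).card : ℝ) =
      (visited γ o l).card + if (γ c)⁻¹ • o ∈ visited γ o l then 0 else 1 := by
  rw [visited]
  have hc : ((visited γ o l).image fun x => γ c • x).card = (visited γ o l).card :=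
    Finset.card_image_of_injective _ (MulAction.injective _)
  split_ifs with h
  · rw [Finset.insert_eq_of_mem (mem_image_smul.2 h), hc, add_zero]
  · rw [Finset.card_insert_of_notMem fun H => h (mem_image_smul.1 H), hc]
    push_cast
    rfl

/-- The visited points that are not visited at a marked time. -/
noncomputable def unmarked (l : List (Bool × Γ)) : Finset X :=
  visited γ o (l.map Prod.snd) \ resampled γ o l

/-- A letter added on the left translates the old unmarked points. If it is marked, it removes `o`
from them; if not, it adds `o` exactly when `o` is a new point, since an `o` visited before keeps
its earlier status. -/
theorem sum_unmarked_cons (f : X → ℝ) (ε : Bool) (c : Γ) (l : List (Bool × Γ)) :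
    ∑ x ∈ unmarked γ o ((ε, c) :: l), f x =
      ∑ x ∈ unmarked γ o l, f (γ c • x) * (if ε = true ∧ γ c • x = o then 0 else 1) +
        if ε = true then 0 else
          (if (γ c)⁻¹ • o ∈ visited γ o (l.map Prod.snd) then 0 else 1) * f o := by
  have himg : ∀ F : X → ℝ, ∑ x ∈ unmarked γ o l, F (γ c • x) =
      ∑ x ∈ (unmarked γ o l).image (fun x => γ c • x), F x := fun F =>
    (Finset.sum_image fun x _ y _ h => MulAction.injective _ h).symm
  have hmem : ∀ x, x ∈ unmarked γ o ((ε, c) :: l) ↔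
      (x = o ∨ (γ c)⁻¹ • x ∈ visited γ o (l.map Prod.snd)) ∧
        ¬((ε = true ∧ x = o) ∨ (γ c)⁻¹ • x ∈ resampled γ o l) := fun x => by
    rw [unmarked, Finset.mem_sdiff, List.map_cons, mem_visited_cons, mem_resampled_cons]
  have hmem' : ∀ x, x ∈ (unmarked γ o l).image (fun x => γ c • x) ↔
      (γ c)⁻¹ • x ∈ visited γ o (l.map Prod.snd) ∧ (γ c)⁻¹ • x ∉ resampled γ o l := fun x => by
    rw [mem_image_smul, unmarked, Finset.mem_sdiff]
  rw [himg fun x => f x * (if ε = true ∧ x = o then 0 else 1)]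
  cases ε with
  | true =>
    have hset : unmarked γ o ((true, c) :: l) =
        ((unmarked γ o l).image (fun x => γ c • x)).filter (fun x => x ≠ o) := by
      ext x
      rw [hmem, Finset.mem_filter, hmem']
      by_cases hx : x = o <;> simp [hx]
    rw [hset, Finset.sum_filter]
    simp [ite_not]
  | false =>
    by_cases ho : (γ c)⁻¹ • o ∈ visited γ o (l.map Prod.snd)
    · have hset : unmarked γ o ((false, c) :: l) = (unmarked γ o l).image (fun x => γ c • x) := by
        ext x
        rw [hmem, hmem']
        by_cases hx : x = o <;> simp [hx, ho]
      rw [hset]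
      simp [ho]
    · have hr : (γ c)⁻¹ • o ∉ resampled γ o l := fun h => ho (resampled_subset γ o l h)
      have hset : unmarked γ o ((false, c) :: l) =
          insert o ((unmarked γ o l).image (fun x => γ c • x)) := by
        ext x
        rw [hmem, Finset.mem_insert, hmem']
        by_cases hx : x = o <;> simp [hx, ho, hr]
      rw [hset, Finset.sum_insert fun h => ho ((hmem' o).1 h).1]
      simp [ho, add_comm]

/-! ### Mean numbers of visited and of unmarked points. -/

variable [Fintype Γ]

/-- The probability that `x` is not visited by a word of length `n`. -/
noncomputable def avoidProb (n : ℕ) (x : X) : ℝ :=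
  pathSum p n fun l => if x ∈ visited γ o l then 0 else 1

/-- The probability that the base point is a new point when a letter is added on the left. -/
noncomputable def birthProb (n : ℕ) : ℝ := ∑ c, p c * avoidProb γ o p n ((γ c)⁻¹ • o)

/-- The mean number of points visited by a word of length `n`. -/
noncomputable def meanVisited (n : ℕ) : ℝ :=
  pathSum p n fun l => ((visited γ o l).card : ℝ)

/-- The law of a marked letter. -/
noncomputable def markedLaw (ρ : ℝ) (e : Bool × Γ) : ℝ := (if e.1 then ρ else 1 - ρ) * p e.2

variable {p}

/-- Translation preserves the number of points, so the increment is the probability that `o` is new.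
-/
theorem meanVisited_succ (n : ℕ) (hp1 : ∑ c, p c = 1) :
    meanVisited γ o p (n + 1) = meanVisited γ o p n + birthProb γ o p n := by
  simp only [meanVisited, pathSum, card_visited_cons, pathSum_add, birthProb, avoidProb, mul_add,
    Finset.sum_add_distrib, ← Finset.sum_mul, hp1, one_mul]

theorem meanVisited_eq_sum (n : ℕ) (hp1 : ∑ c, p c = 1) :
    meanVisited γ o p n = ∑ m ∈ Finset.range n, birthProb γ o p m := by
  induction n with
  | zero => simp [meanVisited, pathSum, visited]
  | succ n ih => rw [meanVisited_succ γ o n hp1, ih, Finset.sum_range_succ]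

theorem avoidProb_succ (n : ℕ) (x : X) :
    avoidProb γ o p (n + 1) x =
      if x = o then 0 else ∑ c, p c * avoidProb γ o p n ((γ c)⁻¹ • x) := by
  simp only [avoidProb, pathSum, mem_visited_cons]
  split_ifs with h
  · simp [h, pathSum_zero]
  · simp [h]

theorem avoidProb_nonneg (hp : ∀ c, 0 ≤ p c) (n : ℕ) (x : X) : 0 ≤ avoidProb γ o p n x :=
  pathSum_nonneg hp n fun l => by split_ifs <;> norm_num

/-- A longer word avoids less. The recursion adds letters on the left, where the visited set is
translated and does not simply grow; hence the induction through `avoidProb_succ`. -/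
theorem avoidProb_succ_le (hp : ∀ c, 0 ≤ p c) (hp1 : ∑ c, p c = 1) (n : ℕ) (x : X) :
    avoidProb γ o p (n + 1) x ≤ avoidProb γ o p n x := by
  induction n generalizing x with
  | zero =>
    rw [avoidProb_succ]
    simp only [avoidProb, pathSum, visited, Finset.notMem_empty, if_false, mul_one, hp1]
    split_ifs <;> norm_num
  | succ n ih =>
    rw [avoidProb_succ, avoidProb_succ (n := n)]
    split_ifs
    · exact le_rfl
    · exact Finset.sum_le_sum fun c _ => mul_le_mul_of_nonneg_left (ih _) (hp c)

theorem birthProb_nonneg (hp : ∀ c, 0 ≤ p c) (n : ℕ) : 0 ≤ birthProb γ o p n :=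
  Finset.sum_nonneg fun c _ => mul_nonneg (hp c) (avoidProb_nonneg γ o hp _ _)

/-- This monotonicity bounds the share of the points created by the last few letters. -/
theorem birthProb_antitone (hp : ∀ c, 0 ≤ p c) (hp1 : ∑ c, p c = 1) :
    Antitone (birthProb γ o p) :=
  antitone_nat_of_succ_le fun n => Finset.sum_le_sum fun c _ =>
    mul_le_mul_of_nonneg_left (avoidProb_succ_le γ o hp hp1 n _) (hp c)

theorem birthProb_zero (hp1 : ∑ c, p c = 1) : birthProb γ o p 0 = 1 := by
  simp [birthProb, avoidProb, pathSum, visited, hp1]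

theorem one_le_meanVisited (hp : ∀ c, 0 ≤ p c) (hp1 : ∑ c, p c = 1) {n : ℕ} (hn : 0 < n) :
    1 ≤ meanVisited γ o p n := by
  rw [meanVisited_eq_sum γ o n hp1, ← birthProb_zero γ o hp1]
  exact Finset.single_le_sum (f := birthProb γ o p) (fun m _ => birthProb_nonneg γ o hp m)
    (Finset.mem_range.2 hn)

variable (p) in
/-- The transition operator of the orbital chain, with a loss of mass `ρ` at each visit of `o`. -/
noncomputable def lossyStep (ρ : ℝ) (f : X → ℝ) (x : X) : ℝ :=
  ∑ c, p c * (f (γ c • x) * if γ c • x = o then 1 - ρ else 1)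

theorem markedLaw_map (ρ : ℝ) (F : Γ → ℝ) :
    ∑ e, markedLaw p ρ e * F e.2 = ∑ c, p c * F c := by
  simp only [markedLaw, Fintype.sum_prod_type, Fintype.sum_bool, if_true, Bool.false_eq_true,
    if_false, ← Finset.sum_add_distrib]
  exact Finset.sum_congr rfl fun c _ => by ring

/-- Averaging `sum_unmarked_cons` over the mark: an old unmarked point makes one step of the orbital
chain and survives a visit of `o` with probability `1 - ρ`; a new point `o` is counted with
probability `1 - ρ`. -/
theorem pathSum_unmarked_succ (ρ : ℝ) (n : ℕ) (f : X → ℝ) :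
    pathSum (markedLaw p ρ) (n + 1) (fun l => ∑ x ∈ unmarked γ o l, f x) =
      pathSum (markedLaw p ρ) n (fun l => ∑ x ∈ unmarked γ o l, lossyStep γ o p ρ f x) +
        (1 - ρ) * birthProb γ o p n * f o := by
  have hb : ∀ c, pathSum (markedLaw p ρ) n
      (fun l => if (γ c)⁻¹ • o ∈ visited γ o (l.map Prod.snd) then (0 : ℝ) else 1) =
        avoidProb γ o p n ((γ c)⁻¹ • o) := fun c =>
    pathSum_map _ p Prod.snd (markedLaw_map ρ) n
      fun l => if (γ c)⁻¹ • o ∈ visited γ o l then (0 : ℝ) else 1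
  have hK : ∀ l, ∑ x ∈ unmarked γ o l, lossyStep γ o p ρ f x = ∑ c, p c *
      (ρ * ∑ x ∈ unmarked γ o l, f (γ c • x) * (if true = true ∧ γ c • x = o then 0 else 1) +
      (1 - ρ) * ∑ x ∈ unmarked γ o l,
        f (γ c • x) * (if false = true ∧ γ c • x = o then 0 else 1)) := by
    intro l
    simp only [lossyStep]
    rw [Finset.sum_comm]
    refine Finset.sum_congr rfl fun c _ => ?_
    simp only [Finset.mul_sum, ← Finset.sum_add_distrib]
    refine Finset.sum_congr rfl fun x _ => ?_
    by_cases h : γ c • x = o <;>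
      simp only [h, if_true, if_false, and_true, and_false, Bool.false_eq_true] <;> ring
  simp only [hK, pathSum_sum, pathSum_const_mul, pathSum_add]
  rw [pathSum, Fintype.sum_prod_type, Fintype.sum_bool]
  simp only [sum_unmarked_cons, pathSum_add, markedLaw, if_true, Bool.false_eq_true, if_false,
    birthProb, Finset.mul_sum, Finset.sum_mul, ← Finset.sum_add_distrib, pathSum_zero]
  refine Finset.sum_congr rfl fun c _ => ?_
  have : pathSum (markedLaw p ρ) n
      (fun l => (if (γ c)⁻¹ • o ∈ visited γ o (l.map Prod.snd) then (0 : ℝ) else 1) * f o) =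
        avoidProb γ o p n ((γ c)⁻¹ • o) * f o := by
    rw [← hb, mul_comm, ← pathSum_const_mul]
    exact pathSum_congr _ fun l _ => mul_comm _ _
  rw [this]
  ring

/-- Decomposition by the date of birth: a point born when a letter is put before a word of length
`m` undergoes the `n - 1 - m` letters added later. -/
theorem pathSum_unmarked (ρ : ℝ) (n : ℕ) (f : X → ℝ) :
    pathSum (markedLaw p ρ) n (fun l => ∑ x ∈ unmarked γ o l, f x) =
      (1 - ρ) * ∑ m ∈ Finset.range n,
        birthProb γ o p m * (lossyStep γ o p ρ)^[n - 1 - m] f o := by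
  induction n generalizing f with
  | zero => simp [pathSum, unmarked, visited]
  | succ n ih =>
    rw [pathSum_unmarked_succ γ o ρ, ih, Finset.sum_range_succ, mul_add]
    congr 1
    · congr 1
      refine Finset.sum_congr rfl fun m hm => ?_
      have hm' := Finset.mem_range.1 hm
      rw [← Function.iterate_succ_apply, show (n - 1 - m).succ = n + 1 - 1 - m by omega]
    · simp [mul_assoc]

/-! ### Loss of mass at a recurrent point. -/

variable (p) in
/-- The probability that the orbital chain from `x` does not visit `o` in the steps `1, …, n`. -/
noncomputable def escapeProb : ℕ → X → ℝ
  | 0, _ => 1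
  | n + 1, x => ∑ c, p c * if γ c • x = o then 0 else escapeProb n (γ c • x)

theorem lossyStep_mono (hp : ∀ c, 0 ≤ p c) {ρ : ℝ} (h1 : ρ ≤ 1) {f g : X → ℝ} (h : f ≤ g) :
    lossyStep γ o p ρ f ≤ lossyStep γ o p ρ g := fun x =>
  Finset.sum_le_sum fun c _ => mul_le_mul_of_nonneg_left
    (mul_le_mul_of_nonneg_right (h _) (by split_ifs <;> linarith)) (hp c)

theorem iterate_lossyStep_nonneg (hp : ∀ c, 0 ≤ p c) {ρ : ℝ} (h1 : ρ ≤ 1) (n : ℕ) (x : X) :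
    0 ≤ (lossyStep γ o p ρ)^[n] (fun _ => 1) x := by
  induction n generalizing x with
  | zero => exact zero_le_one
  | succ n ih =>
    rw [Function.iterate_succ_apply']
    exact Finset.sum_nonneg fun c _ => mul_nonneg (hp c)
      (mul_nonneg (ih _) (by split_ifs <;> linarith))

theorem iterate_lossyStep_antitone (hp : ∀ c, 0 ≤ p c) (hp1 : ∑ c, p c = 1) {ρ : ℝ} (h0 : 0 ≤ ρ)
    (h1 : ρ ≤ 1) : Antitone fun n => (lossyStep γ o p ρ)^[n] (fun _ => 1) := by
  refine antitone_nat_of_succ_le fun n => ?_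
  rw [Function.iterate_succ_apply]
  have h : lossyStep γ o p ρ (fun _ => 1) ≤ fun _ => 1 := fun x => by
    refine le_trans (Finset.sum_le_sum fun c _ => ?_) hp1.le
    rw [one_mul]
    exact mul_le_of_le_one_right (hp c) (by split_ifs <;> linarith)
  exact Monotone.iterate (fun f g => lossyStep_mono γ o hp h1) n h

/-- Either `o` is not visited in the first `T` steps, or at the first visit a factor `1 - ρ` is lost
and at least `t` steps from `o` remain, with surviving mass nonincreasing in time. -/
theorem iterate_lossyStep_le (hp : ∀ c, 0 ≤ p c) (hp1 : ∑ c, p c = 1) {ρ : ℝ} (h0 : 0 ≤ ρ)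
    (h1 : ρ ≤ 1) (t T : ℕ) (x : X) :
    (lossyStep γ o p ρ)^[T + t] (fun _ => 1) x ≤
      escapeProb γ o p T x + (1 - ρ) * (lossyStep γ o p ρ)^[t] (fun _ => 1) o := by
  have hanti := iterate_lossyStep_antitone γ o hp hp1 h0 h1
  have hnn := iterate_lossyStep_nonneg γ o hp h1
  have hu : 0 ≤ (1 - ρ) * (lossyStep γ o p ρ)^[t] (fun _ => 1) o :=
    mul_nonneg (by linarith) (hnn _ _)
  induction T generalizing x with
  | zero =>
    have := hanti (Nat.zero_le (0 + t)) x
    simp only [Function.iterate_zero, id_eq] at this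
    simp only [escapeProb]
    linarith
  | succ T ih =>
    rw [show T + 1 + t = (T + t) + 1 by ring, Function.iterate_succ_apply', lossyStep, escapeProb]
    set u := (1 - ρ) * (lossyStep γ o p ρ)^[t] (fun _ => 1) o with hu_def
    have hs : u = ∑ c, p c * u := by rw [← Finset.sum_mul, hp1, one_mul]
    rw [hs, ← Finset.sum_add_distrib]
    refine Finset.sum_le_sum fun c _ => ?_
    rw [← mul_add]
    refine mul_le_mul_of_nonneg_left ?_ (hp c)
    by_cases h : γ c • x = o
    · simp only [h, if_true, zero_add]
      rw [mul_comm]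
      exact mul_le_mul_of_nonneg_left (hanti (Nat.le_add_left t T) o) (by linarith)
    · simp only [h, if_false, mul_one]
      exact ih _

/-- If the orbital chain is recurrent at `o`, then a positive loss of mass at each visit of `o`
exhausts the total mass. -/
theorem exists_iterate_lossyStep_le (hp : ∀ c, 0 ≤ p c) (hp1 : ∑ c, p c = 1)
    (hrec : ∀ δ > 0, ∃ T, escapeProb γ o p T o ≤ δ) {ρ : ℝ} (h0 : 0 < ρ) (h1 : ρ ≤ 1)
    {δ : ℝ} (hδ : 0 < δ) :
    ∃ t, ∀ n, t ≤ n → (lossyStep γ o p ρ)^[n] (fun _ => 1) o ≤ δ := by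
  have hanti := iterate_lossyStep_antitone γ o hp hp1 h0.le h1
  have hnn := iterate_lossyStep_nonneg γ o hp h1
  set u : ℕ → ℝ := fun n => (lossyStep γ o p ρ)^[n] (fun _ => 1) o with hu
  have hua : Antitone u := fun m n h => hanti h o
  have hbdd : BddBelow (Set.range u) := ⟨0, by rintro _ ⟨n, rfl⟩; exact hnn n o⟩
  have hlim := tendsto_atTop_ciInf hua hbdd
  set L := ⨅ n, u n
  have hL : L ≤ 0 := by
    by_contra hL
    push Not at hL
    -- With `T` fixed and `t → ∞`, the first-visit inequality gives `L ≤ ρ L / 2 + (1 - ρ) L`, which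
    -- is impossible for `L > 0`.
    obtain ⟨T, hT⟩ := hrec (ρ * L / 2) (by positivity)
    have hle : L ≤ ρ * L / 2 + (1 - ρ) * L := by
      refine ge_of_tendsto
        ((hlim.const_mul (1 - ρ)).const_add (ρ * L / 2)) (Filter.Eventually.of_forall fun t => ?_)
      exact (ciInf_le hbdd (T + t)).trans
        ((iterate_lossyStep_le γ o hp hp1 h0.le h1 t T o).trans (by gcongr))
    have : 0 < ρ * L := mul_pos h0 hL
    linarith
  obtain ⟨t, ht⟩ := (hlim.eventually (gt_mem_nhds (hL.trans_lt hδ))).exists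
  exact ⟨t, fun n hn => (hua hn).trans ht.le⟩

/-- If the orbital chain is recurrent at `o`, then for large `n` half of the visited points are
visited at a marked time, in the mean. -/
theorem half_meanVisited_le (hp : ∀ c, 0 ≤ p c) (hp1 : ∑ c, p c = 1)
    (hrec : ∀ δ > 0, ∃ T, escapeProb γ o p T o ≤ δ) {ρ : ℝ} (h0 : 0 < ρ) (h1 : ρ ≤ 1) :
    ∀ᶠ n : ℕ in Filter.atTop, 1 / 2 * meanVisited γ o p n ≤
      pathSum (markedLaw p ρ) n fun l => ((resampled γ o l).card : ℝ) := by
  obtain ⟨t, ht⟩ := exists_iterate_lossyStep_le γ o hp hp1 hrec h0 h1 (show (0 : ℝ) < 1 / 4 by norm_num)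
  have hnn := iterate_lossyStep_nonneg γ o hp h1
  have hle1 : ∀ n, (lossyStep γ o p ρ)^[n] (fun _ => 1) o ≤ 1 := fun n =>
    iterate_lossyStep_antitone γ o hp hp1 h0.le h1 (Nat.zero_le n) o
  -- From `n ≥ 5 t + 1` follows `n - t ≥ 4 t`. As births are nonincreasing, the last `t` of them
  -- weigh at most a quarter of the others. The earlier points stay unmarked with probability at
  -- most `1/4`, so at most half of the mean remains unmarked.
  filter_upwards [Filter.eventually_ge_atTop (5 * t + 1)] with n hn
  have hcard : pathSum (markedLaw p ρ) n (fun l => ((resampled γ o l).card : ℝ)) =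
      meanVisited γ o p n - pathSum (markedLaw p ρ) n (fun l => ∑ x ∈ unmarked γ o l, 1) := by
    rw [meanVisited, ← pathSum_map (markedLaw p ρ) p Prod.snd (markedLaw_map ρ) n
      (fun l => ((visited γ o l).card : ℝ)), ← pathSum_sub]
    refine pathSum_congr _ fun l _ => ?_
    have := Finset.card_sdiff_add_card_eq_card (resampled_subset γ o l)
    rw [← this, unmarked]
    push_cast
    simp
  have hb := birthProb_nonneg γ o hp
  have hm := meanVisited_eq_sum γ o n hp1
  have hsplit : meanVisited γ o p n = (∑ m ∈ Finset.range (n - t), birthProb γ o p m) +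
      ∑ i ∈ Finset.range t, birthProb γ o p (n - t + i) := by
    rw [hm, ← Finset.sum_range_add, Nat.sub_add_cancel (by omega)]
  have hhead : ((n - t : ℕ) : ℝ) * birthProb γ o p (n - t) ≤
      ∑ m ∈ Finset.range (n - t), birthProb γ o p m := by
    have := Finset.card_nsmul_le_sum (Finset.range (n - t)) (birthProb γ o p)
      (birthProb γ o p (n - t)) fun m hm =>
        birthProb_antitone γ o hp hp1 (Finset.mem_range.1 hm).le
    simpa using this
  have htail : ∑ i ∈ Finset.range t, birthProb γ o p (n - t + i) ≤
      (t : ℝ) * birthProb γ o p (n - t) := by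
    have := Finset.sum_le_card_nsmul (Finset.range t) (fun i => birthProb γ o p (n - t + i))
      (birthProb γ o p (n - t)) fun m hm =>
        birthProb_antitone γ o hp hp1 (Nat.le_add_right _ _)
    simpa using this
  have hunm : pathSum (markedLaw p ρ) n (fun l => ∑ x ∈ unmarked γ o l, 1) ≤
      1 / 4 * (∑ m ∈ Finset.range (n - t), birthProb γ o p m) +
        ∑ i ∈ Finset.range t, birthProb γ o p (n - t + i) := by
    rw [pathSum_unmarked γ o ρ]
    have hsum : ∑ m ∈ Finset.range n,
        birthProb γ o p m * (lossyStep γ o p ρ)^[n - 1 - m] (fun _ => 1) o ≤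
        1 / 4 * (∑ m ∈ Finset.range (n - t), birthProb γ o p m) +
        ∑ i ∈ Finset.range t, birthProb γ o p (n - t + i) := by
      conv_lhs => rw [← Nat.sub_add_cancel (show t ≤ n by omega), Finset.sum_range_add]
      rw [Finset.mul_sum]
      refine add_le_add (Finset.sum_le_sum fun m hm => ?_) (Finset.sum_le_sum fun i _ => ?_)
      · rw [mul_comm]
        refine mul_le_mul_of_nonneg_right (ht _ ?_) (hb m)
        have := Finset.mem_range.1 hm
        omega
      · exact mul_le_of_le_one_right (hb _) (hle1 _)
    have hnn' : 0 ≤ ∑ m ∈ Finset.range n,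
        birthProb γ o p m * (lossyStep γ o p ρ)^[n - 1 - m] (fun _ => 1) o :=
      Finset.sum_nonneg fun m _ => mul_nonneg (hb m) (hnn _ _)
    refine le_trans ?_ hsum
    exact mul_le_of_le_one_left hnn' (by linarith)
  have h4 : (4 * t : ℝ) ≤ ((n - t : ℕ) : ℝ) := by
    exact_mod_cast (show 4 * t ≤ n - t by omega)
  have h5 := mul_le_mul_of_nonneg_right h4 (hb (n - t))
  have h6 : 0 ≤ ∑ m ∈ Finset.range (n - t), birthProb γ o p m :=
    Finset.sum_nonneg fun m _ => hb m
  rw [hcard]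
  linarith

end Renewal

/-! ## Random walks as images of words, and entropy estimates -/

section Entropy

open scoped Classical

/-- Gibbs' inequality against a weight of total mass at most `B`, from `log t ≤ t - 1` at `t = w x /
(B q x)`. -/
theorem sum_negMulLog_le {α : Type*} (s : Finset α) {q w : α → ℝ} {B : ℝ} (hB : 0 < B)
    (hq : ∀ x, 0 ≤ q x) (hw : ∀ x, 0 ≤ w x) (hqw : ∀ x, q x ≠ 0 → 0 < w x)
    (hq1 : ∑ x ∈ s, q x = 1) (hwB : ∑ x ∈ s, w x ≤ B) :
    ∑ x ∈ s, Real.negMulLog (q x) ≤ Real.log B + ∑ x ∈ s, q x * -Real.log (w x) := by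
  have key : ∀ x, Real.negMulLog (q x) ≤
      q x * Real.log B + q x * -Real.log (w x) + (w x / B - q x) := by
    intro x
    by_cases hx : q x = 0
    · simp [hx, div_nonneg (hw x) hB.le]
    · have hq0 : 0 < q x := lt_of_le_of_ne (hq x) (Ne.symm hx)
      have hw0 := hqw x hx
      have h := Real.log_le_sub_one_of_pos (show 0 < w x / B / q x by positivity)
      rw [Real.log_div (by positivity) hx, Real.log_div hw0.ne' hB.ne'] at h
      have h' := mul_le_mul_of_nonneg_left h hq0.le
      have h2 : q x * (w x / B / q x - 1) = w x / B - q x := by field_simp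
      rw [h2] at h'
      rw [Real.negMulLog]
      linarith
  refine (Finset.sum_le_sum fun x _ => key x).trans ?_
  rw [Finset.sum_add_distrib, Finset.sum_add_distrib, ← Finset.sum_mul, Finset.sum_sub_distrib,
    ← Finset.sum_div, hq1, one_mul]
  have : (∑ x ∈ s, w x) / B ≤ 1 := (div_le_one hB).2 hwB
  linarith

variable {Ω : Type*} [Fintype Ω] {P : Ω → ℝ}

/-- Gibbs' inequality for the law of `X`: a weight of mass at most `B` that is not too small at the
values of `X` bounds the entropy. It only has to be estimated along each outcome `ω`, not as a
function of the value. -/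
theorem shannonEntropy_le {W : Type*} (ξ : PMF W) (hP1 : ∑ ω, P ω = 1)
    (X : Ω → W) (hξ : ∀ x, (ξ x).toReal = ∑ ω, P ω * if X ω = x then 1 else 0)
    {w : W → ℝ} {B : ℝ} (hB : 0 < B) (hw : ∀ x, 0 ≤ w x) (hwX : ∀ ω, 0 < w (X ω))
    (hwB : ∀ s : Finset W, ∑ x ∈ s, w x ≤ B) :
    shannonEntropy ξ ≤ Real.log B + ∑ ω, P ω * -Real.log (w (X ω)) := by
  have hsum : ∀ F : W → ℝ, ∑ x ∈ Finset.univ.image X, (ξ x).toReal * F x =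
      ∑ ω, P ω * F (X ω) := by
    intro F
    simp only [hξ, Finset.sum_mul]
    rw [Finset.sum_comm]
    refine Finset.sum_congr rfl fun ω _ => ?_
    rw [Finset.sum_eq_single (X ω)]
    · simp
    · intro x _ hx
      simp [hx.symm]
    · intro h
      exact absurd (Finset.mem_image_of_mem _ (Finset.mem_univ _)) h
  have hout : ∀ x, (∀ ω, X ω ≠ x) → (ξ x).toReal = 0 := by
    intro x hx
    rw [hξ]
    exact Finset.sum_eq_zero fun ω _ => by simp [hx ω]
  rw [shannonEntropy, tsum_eq_sum (s := Finset.univ.image X), ← hsum fun x => -Real.log (w x)]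
  · refine sum_negMulLog_le _ hB (fun x => ENNReal.toReal_nonneg) hw (fun x hx => ?_) ?_ (hwB _)
    · by_contra h
      exact hx (hout x fun ω hω => h (hω ▸ hwX ω))
    · simpa [hP1] using hsum fun _ => 1
  · intro x hx
    rw [hout x fun ω hω => hx (hω ▸ Finset.mem_image_of_mem _ (Finset.mem_univ _)),
      Real.negMulLog_zero]

theorem PMF.map_fst_apply {α β : Type*} (π : PMF (α × β)) (x : α) :
    (π.map Prod.fst) x = ∑' y, π (x, y) := by
  rw [PMF.map_apply, ENNReal.tsum_prod', tsum_eq_single x]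
  · simp
  · intro x' hx'
    simp [hx'.symm]

/-- If the conditional laws `κ ω` of the second coordinate given a variable `ω` that determines the
first one have atoms of mass at most `exp (- N ω)`, then the conditional entropy of the second
coordinate given the first one is at least the mean of `N`. -/
theorem sum_le_conditionalEntropy {α β : Type*} (π : PMF (α × β)) (hP : ∀ ω, 0 ≤ P ω)
    (X : Ω → α) (κ : Ω → β → ℝ) (N : Ω → ℝ)
    (hπ : ∀ x y, (π (x, y)).toReal = ∑ ω, P ω * ((if X ω = x then 1 else 0) * κ ω y))
    (hκ : ∀ ω y, 0 ≤ κ ω y) (hfin : ∀ ω, (Function.support (κ ω)).Finite)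
    (hκ1 : ∀ ω, HasSum (κ ω) 1) (hN : ∀ ω y, κ ω y ≤ Real.exp (-N ω)) :
    ∑ ω, P ω * N ω ≤ conditionalEntropy π := by
  set T : Finset β := Finset.univ.biUnion fun ω => (hfin ω).toFinset with hT
  have hmemT : ∀ ω y, κ ω y ≠ 0 → y ∈ T := fun ω y h =>
    Finset.mem_biUnion.2 ⟨ω, Finset.mem_univ _, (hfin ω).mem_toFinset.2 h⟩
  have hκT : ∀ ω, ∑ y ∈ T, κ ω y = 1 := fun ω =>
    (hasSum_sum_of_ne_finset_zero fun y hy => by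
      by_contra h
      exact hy (hmemT ω y h)).unique (hκ1 ω)
  have hπT : ∀ x y, y ∉ T → (π (x, y)).toReal = 0 := by
    intro x y hy
    rw [hπ]
    refine Finset.sum_eq_zero fun ω _ => ?_
    rw [show κ ω y = 0 by by_contra h; exact hy (hmemT ω y h), mul_zero, mul_zero]
  set m : α → ℝ := fun x => ((π.map Prod.fst) x).toReal with hm
  have hmπ : ∀ x, m x = ∑ y ∈ T, (π (x, y)).toReal := by
    intro x
    simp only [hm]
    rw [PMF.map_fst_apply, ENNReal.tsum_toReal_eq fun y => PMF.apply_ne_top _ _]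
    exact tsum_eq_sum fun y hy => hπT x y hy
  have hmP : ∀ x, m x = ∑ ω, P ω * if X ω = x then 1 else 0 := by
    intro x
    rw [hmπ]
    simp only [hπ]
    rw [Finset.sum_comm]
    refine Finset.sum_congr rfl fun ω _ => ?_
    rw [← Finset.mul_sum, ← Finset.mul_sum, hκT, mul_one]
  have hmnn : ∀ x, 0 ≤ m x := fun x => ENNReal.toReal_nonneg
  have hterm : ∀ x, ∑ ω, P ω * (if X ω = x then 1 else 0) * N ω ≤
      m x * ∑' y, Real.negMulLog ((π (x, y)).toReal / m x) := by
    intro x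
    rw [tsum_eq_sum (s := T) fun y hy => by rw [hπT x y hy, zero_div, Real.negMulLog_zero]]
    rcases (hmnn x).eq_or_lt with h0 | h0
    · rw [← h0, zero_mul]
      have h0' := hmP x
      rw [← h0] at h0'
      have := (Finset.sum_eq_zero_iff_of_nonneg (fun ω _ => mul_nonneg (hP ω)
        (by split_ifs <;> norm_num))).1 h0'.symm
      exact le_of_eq (Finset.sum_eq_zero fun ω hω => by rw [this ω hω, zero_mul])
    · have hrew : m x * ∑ y ∈ T, Real.negMulLog ((π (x, y)).toReal / m x) =
          ∑ ω, P ω * (if X ω = x then 1 else 0) *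
            ∑ y ∈ T, κ ω y * -Real.log ((π (x, y)).toReal / m x) := by
        simp only [Finset.mul_sum]
        rw [Finset.sum_comm]
        refine Finset.sum_congr rfl fun y _ => ?_
        rw [Real.negMulLog]
        rw [show m x * (-((π (x, y)).toReal / m x) * Real.log ((π (x, y)).toReal / m x)) =
          (π (x, y)).toReal * -Real.log ((π (x, y)).toReal / m x) by field_simp]
        nth_rw 1 [hπ]
        rw [Finset.sum_mul]
        exact Finset.sum_congr rfl fun ω _ => by ring
      rw [hrew]
      refine Finset.sum_le_sum fun ω _ => ?_
      by_cases hω : P ω * (if X ω = x then 1 else 0) = 0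
      · rw [hω, zero_mul, zero_mul]
      have hω0 : 0 ≤ P ω * (if X ω = x then 1 else 0) :=
        mul_nonneg (hP ω) (by split_ifs <;> norm_num)
      refine mul_le_mul_of_nonneg_left ?_ hω0
      -- The law of the second coordinate given `x` is a mixture of the `κ ω` with `X ω = x`. By
      -- Gibbs, the cross entropy of `κ ω` against this mixture is at least the entropy of `κ ω`,
      -- hence at least `N ω` by the bound on its atoms.
      have hgibbs := sum_negMulLog_le T one_pos (hκ ω)
        (fun y => div_nonneg (ENNReal.toReal_nonneg (a := π (x, y))) (hmnn x)) (fun y hy => ?_)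
        (hκT ω) ?_
      · rw [Real.log_one, zero_add] at hgibbs
        refine le_trans ?_ hgibbs
        rw [← one_mul (N ω), ← hκT ω, Finset.sum_mul]
        refine Finset.sum_le_sum fun y _ => ?_
        rcases (hκ ω y).eq_or_lt with h | h
        · rw [← h, zero_mul, Real.negMulLog_zero]
        · have := Real.log_le_log h (hN ω y)
          rw [Real.log_exp] at this
          have := mul_le_mul_of_nonneg_left this h.le
          rw [Real.negMulLog]
          linarith
      · refine div_pos (lt_of_lt_of_le ?_ (?_ : P ω * ((if X ω = x then 1 else 0) * κ ω y) ≤ _)) h0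
        · rw [← mul_assoc]
          exact mul_pos (lt_of_le_of_ne hω0 (Ne.symm hω)) (lt_of_le_of_ne (hκ ω y) (Ne.symm hy))
        · rw [hπ]
          exact Finset.single_le_sum (f := fun ω => P ω * ((if X ω = x then 1 else 0) * κ ω y))
            (fun ω _ => mul_nonneg (hP ω) (mul_nonneg (by split_ifs <;> norm_num) (hκ ω y)))
            (Finset.mem_univ ω)
      · rw [← Finset.sum_div, ← hmπ, div_self h0.ne']
  rw [conditionalEntropy, tsum_eq_sum (s := Finset.univ.image X)]
  · refine le_trans (le_of_eq ?_) (Finset.sum_le_sum fun x _ => hterm x)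
    rw [Finset.sum_comm]
    refine Finset.sum_congr rfl fun ω _ => ?_
    rw [Finset.sum_eq_single (X ω)]
    · simp
    · intro x _ hx
      simp [hx.symm]
    · intro h
      exact absurd (Finset.mem_image_of_mem _ (Finset.mem_univ _)) h
  · intro x hx
    have : m x = 0 := by
      rw [hmP]
      refine Finset.sum_eq_zero fun ω _ => ?_
      rw [if_neg fun h => hx (by rw [← h]; exact Finset.mem_image_of_mem _ (Finset.mem_univ _)),
      mul_zero]
    change m x * _ = 0
    rw [this, zero_mul]

end Entropy

/-! ### Laws of walks whose steps are images of random letters. -/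

section Walks

open scoped Classical

variable {W : Type*} [Group W]

theorem convolution_assoc (a b c : PMF W) :
    convolution (convolution a b) c = convolution a (convolution b c) := by
  simp only [convolution, PMF.bind_bind, PMF.bind_map, PMF.map_bind, PMF.map_comp,
    Function.comp_def, mul_assoc]

theorem convolution_pure_one (a : PMF W) : convolution a (PMF.pure 1) = a := by
  simp only [convolution, PMF.pure_map, mul_one, PMF.bind_pure]

theorem pure_one_convolution (a : PMF W) : convolution (PMF.pure 1) a = a := by
  simp only [convolution, PMF.pure_bind, one_mul]
  exact PMF.map_id a

/-- The walk is defined by multiplication on the right, whereas inverted orbits are analysed by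
peeling off the first letter. -/
theorem walkLaw_succ_left (μ : PMF W) (n : ℕ) :
    walkLaw μ (n + 1) = convolution μ (walkLaw μ n) := by
  induction n with
  | zero => simp only [walkLaw, convolution_pure_one, pure_one_convolution]
  | succ n ih => rw [walkLaw, ih, convolution_assoc, ← walkLaw, ih]

theorem PMF.map_mul_left_apply (ν : PMF W) (g x : W) :
    (ν.map fun y => g * y) x = ν (g⁻¹ * x) := by
  rw [PMF.map_apply, tsum_eq_single (g⁻¹ * x)]
  · simp
  · intro y hy
    rw [if_neg fun h => hy (by rw [h, inv_mul_cancel_left])]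

theorem convolution_apply (μ ν : PMF W) (x : W) :
    convolution μ ν x = ∑' s, μ s * ν (s⁻¹ * x) := by
  simp only [convolution, PMF.bind_apply, PMF.map_mul_left_apply]

theorem convolution_map_apply {A : Type*} [Fintype A] (q : PMF A) (f : A → W) (ν : PMF W)
    (x : W) : convolution (q.map f) ν x = ∑ a, q a * ν ((f a)⁻¹ * x) := by
  simp only [convolution, PMF.bind_map, PMF.bind_apply, Function.comp_def,
    PMF.map_mul_left_apply, tsum_fintype]

variable {A : Type*} [Fintype A] (q : PMF A)

theorem sum_toReal_eq_one : ∑ a, (q a).toReal = 1 := by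
  have h := q.tsum_coe
  rw [tsum_fintype] at h
  rw [← ENNReal.toReal_sum fun a _ => PMF.apply_ne_top q a, h, ENNReal.toReal_one]

theorem walkLaw_map_toReal (f : A → W) (n : ℕ) (x : W) :
    (walkLaw (q.map f) n x).toReal =
      pathSum (fun a => (q a).toReal) n fun l => if (l.map f).prod = x then 1 else 0 := by
  induction n generalizing x with
  | zero =>
    simp only [walkLaw, pathSum, List.map_nil, List.prod_nil, PMF.pure_apply]
    by_cases h : x = 1 <;> simp [h, eq_comm]
  | succ n ih =>
    rw [walkLaw_succ_left, convolution_map_apply, ENNReal.toReal_sum fun a _ =>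
      ENNReal.mul_ne_top (PMF.apply_ne_top _ _) (PMF.apply_ne_top _ _)]
    refine Finset.sum_congr rfl fun a _ => ?_
    rw [ENNReal.toReal_mul, ih]
    simp only [List.map_cons, List.prod_cons, eq_inv_mul_iff_mul_eq]

theorem noisyWalkLaw_succ_toReal (f : A → W) (ρ : unitInterval) (n : ℕ) (x y : W) :
    (noisyWalkLaw (q.map f) ρ (n + 1) (x, y)).toReal = ∑ a, (q a).toReal *
      ((1 - ρ) * (noisyWalkLaw (q.map f) ρ n ((f a)⁻¹ * x, (f a)⁻¹ * y)).toReal +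
        ρ * ∑ b, (q b).toReal *
          (noisyWalkLaw (q.map f) ρ n ((f a)⁻¹ * x, (f b)⁻¹ * y)).toReal) := by
  set ν := noisyWalkLaw (q.map f) ρ n with hν
  have h1 : noisyWalkLaw (q.map f) ρ (n + 1) (x, y) =
      ENNReal.ofReal (1 - (ρ : ℝ)) *
        convolution (((q.map f).map fun s => (s, s))) ν (x, y) +
      ENNReal.ofReal (ρ : ℝ) *
        convolution ((q.map f).bind fun s => (q.map f).map fun s' => (s, s')) ν (x, y) := by
    rw [noisyWalkLaw, walkLaw_succ_left, convolution_apply, convolution_apply, convolution_apply,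
      ← ENNReal.tsum_mul_left, ← ENNReal.tsum_mul_left, ← ENNReal.tsum_add]
    refine tsum_congr fun s => ?_
    have hs : noisyStep (q.map f) ρ s = ENNReal.ofReal (1 - (ρ : ℝ)) *
        ((q.map f).map fun s => (s, s)) s + ENNReal.ofReal (ρ : ℝ) *
          ((q.map f).bind fun s => (q.map f).map fun s' => (s, s')) s := rfl
    rw [hs, add_mul, mul_assoc, mul_assoc]
    rfl
  have h2 : convolution ((q.map f).map fun s => (s, s)) ν (x, y) =
      ∑ a, q a * ν ((f a)⁻¹ * x, (f a)⁻¹ * y) := by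
    rw [PMF.map_comp, convolution_map_apply]
    rfl
  have h3 : convolution ((q.map f).bind fun s => (q.map f).map fun s' => (s, s')) ν (x, y) =
      ∑ a, q a * ∑ b, q b * ν ((f a)⁻¹ * x, (f b)⁻¹ * y) := by
    simp only [convolution, PMF.bind_map, PMF.bind_bind, PMF.map_comp, Function.comp_def,
      PMF.bind_apply, tsum_fintype, PMF.map_mul_left_apply]
    rfl
  have hne : ∀ z, ν z ≠ ⊤ := fun z => PMF.apply_ne_top _ _
  have hq : ∀ a, q a ≠ ⊤ := fun a => PMF.apply_ne_top _ _
  have hS : ∀ F : A → ENNReal, (∀ a, F a ≠ ⊤) → ∑ a, q a * F a ≠ ⊤ := fun F hF =>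
    ENNReal.sum_ne_top.2 fun a _ => ENNReal.mul_ne_top (hq a) (hF a)
  have hT : ∀ F : A → ENNReal, (∀ a, F a ≠ ⊤) →
      (∑ a, q a * F a).toReal = ∑ a, (q a).toReal * (F a).toReal := fun F hF => by
    rw [ENNReal.toReal_sum fun a _ => ENNReal.mul_ne_top (hq a) (hF a)]
    simp only [ENNReal.toReal_mul]
  rw [h1, h2, h3, ENNReal.toReal_add (ENNReal.mul_ne_top ENNReal.ofReal_ne_top
      (hS _ fun a => hne _)) (ENNReal.mul_ne_top ENNReal.ofReal_ne_top
      (hS _ fun a => hS _ fun b => hne _)), ENNReal.toReal_mul, ENNReal.toReal_mul,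
    ENNReal.toReal_ofReal (sub_nonneg.2 ρ.2.2), ENNReal.toReal_ofReal ρ.2.1,
    hT _ fun a => hne _, hT _ fun a => hS _ fun b => hne _, Finset.mul_sum, Finset.mul_sum,
    ← Finset.sum_add_distrib]
  refine Finset.sum_congr rfl fun a _ => ?_
  rw [hT _ fun b => hne _]
  ring

end Walks

/-! ## Conditional entropy of switch-walks on permutational wreath products -/

section SwitchWalks

open scoped Classical

variable {Λ Γ G X : Type*} [Group Λ] [Group G] [MulAction G X] (γ : Γ → G) (o : X)

/-- The element `δ_l g` of the wreath product. -/
noncomputable def switchStep (a : Λ × Γ) : PermWreath Λ X G :=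
  SemidirectProduct.inl (deltaFun o a.1) * SemidirectProduct.inr (γ a.2)

theorem switchStep_mul_left (a : Λ × Γ) (y : PermWreath Λ X G) (x : X) :
    (switchStep γ o a * y).left.1 x =
      (Pi.mulSingle o a.1 : X → Λ) x * y.left.1 ((γ a.2)⁻¹ • x) := by
  simp only [switchStep, SemidirectProduct.mul_left, SemidirectProduct.left_inl,
    SemidirectProduct.right_inl, SemidirectProduct.left_inr, SemidirectProduct.right_inr,
    SemidirectProduct.mul_right, map_one, one_mul, mul_one]
  rfl

theorem switchStep_mul_left_self (a : Λ × Γ) (y : PermWreath Λ X G) :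
    (switchStep γ o a * y).left.1 o = a.1 * y.left.1 ((γ a.2)⁻¹ • o) := by
  rw [switchStep_mul_left, Pi.mulSingle_eq_same]

theorem switchStep_mul_left_of_ne (a : Λ × Γ) (y : PermWreath Λ X G) {x : X} (hx : x ≠ o) :
    (switchStep γ o a * y).left.1 x = y.left.1 ((γ a.2)⁻¹ • x) := by
  rw [switchStep_mul_left, Pi.mulSingle_eq_of_ne hx, one_mul]

theorem switchStep_mul_right (a : Λ × Γ) (y : PermWreath Λ X G) :
    (switchStep γ o a * y).right = γ a.2 * y.right := by
  simp only [switchStep, SemidirectProduct.mul_right, SemidirectProduct.right_inl,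
    SemidirectProduct.right_inr, one_mul]

/-- Expresses the lamps of `y` through those of the remainder after the first letter, the form used
in inductions on words. -/
theorem left_apply_eq (a : Λ × Γ) (y : PermWreath Λ X G) (x : X) :
    y.left.1 x = (Pi.mulSingle o a.1 : X → Λ) x *
      ((switchStep γ o a)⁻¹ * y).left.1 ((γ a.2)⁻¹ • x) := by
  rw [← switchStep_mul_left, mul_inv_cancel_left]

/-- The letters of the noisy switch-walk, without the resampled lamps: a mark which tells if the
letter is resampled, the original letter, and the resampled group element. -/
abbrev NoisyLetter (Λ Γ : Type*) : Type _ := Bool × (Λ × Γ) × Γ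

/-- The mark and the group element of the noisy letter. -/
def NoisyLetter.marked (z : NoisyLetter Λ Γ) : Bool × Γ := (z.1, if z.1 then z.2.2 else z.2.1.2)

theorem card_resampled_cons (e : Bool × Γ) (l : List (Bool × Γ)) :
    (resampled γ o (e :: l)).card = (resampled γ o l).card +
      if e.1 = true ∧ (γ e.2)⁻¹ • o ∉ resampled γ o l then 1 else 0 := by
  obtain ⟨ε, c⟩ := e
  have hc : ((resampled γ o l).image fun x => γ c • x).card = (resampled γ o l).card :=
    Finset.card_image_of_injective _ (MulAction.injective _)
  cases ε with
  | false => simp only [resampled, Bool.false_eq_true, if_false, hc, false_and, add_zero]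
  | true =>
    simp only [resampled, if_true, true_and]
    split_ifs with h
    · rw [Finset.insert_eq_of_mem (mem_image_smul.2 h), hc, add_zero]
    · rw [Finset.card_insert_of_notMem fun H => h (mem_image_smul.1 H), hc]

variable [Fintype Λ]

/-- The law of the noisy switch-walk, when everything but the resampled lamps is given. -/
noncomputable def lampKernel : List (NoisyLetter Λ Γ) → PermWreath Λ X G → ℝ
  | [], y => if y = 1 then 1 else 0
  | z :: l, y =>
    if z.1 then ∑ a, (Fintype.card Λ : ℝ)⁻¹ * lampKernel l ((switchStep γ o (a, z.2.2))⁻¹ * y)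
    else lampKernel l ((switchStep γ o z.2.1)⁻¹ * y)

theorem lampKernel_nonneg (l : List (NoisyLetter Λ Γ)) (y : PermWreath Λ X G) :
    0 ≤ lampKernel γ o l y := by
  induction l generalizing y with
  | nil => rw [lampKernel]; split_ifs <;> norm_num
  | cons z l ih =>
    rw [lampKernel]
    split_ifs
    · exact Finset.sum_nonneg fun a _ => mul_nonneg (by positivity) (ih _)
    · exact ih _

theorem lampKernel_support_finite (l : List (NoisyLetter Λ Γ)) :
    (Function.support (lampKernel (X := X) γ o l)).Finite := by
  induction l with
  | nil =>
    refine (Set.finite_singleton (1 : PermWreath Λ X G)).subset fun y hy => ?_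
    by_contra h
    exact hy (if_neg h)
  | cons z l ih =>
    have hs : ∀ s : PermWreath Λ X G, (Function.support fun y => lampKernel γ o l (s⁻¹ * y)).Finite :=
      fun s => ih.preimage ((mul_right_injective _).injOn)
    rcases hz : z.1 with _ | _
    · simpa only [lampKernel, hz, Bool.false_eq_true, if_false] using hs _
    · simp only [lampKernel, hz, if_true]
      refine (Set.finite_iUnion fun a : Λ => hs (switchStep γ o (a, z.2.2))).subset fun y hy => ?_
      obtain ⟨a, -, ha⟩ := Finset.exists_ne_zero_of_sum_ne_zero hy
      exact Set.mem_iUnion.2 ⟨a, right_ne_zero_of_mul ha⟩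

theorem lampKernel_hasSum (l : List (NoisyLetter Λ Γ)) :
    HasSum (lampKernel (X := X) γ o l) 1 := by
  induction l with
  | nil => exact hasSum_ite_eq (1 : PermWreath Λ X G) (1 : ℝ)
  | cons z l ih =>
    have hs : ∀ s : PermWreath Λ X G, HasSum (fun y => lampKernel γ o l (s⁻¹ * y)) 1 :=
      fun s => (Equiv.mulLeft s⁻¹).hasSum_iff.2 ih
    rcases hz : z.1 with _ | _
    · simpa only [lampKernel, hz, Bool.false_eq_true, if_false] using hs _
    · simp only [lampKernel, hz, if_true]
      have h := hasSum_sum (s := Finset.univ) fun (a : Λ) _ =>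
        (hs (switchStep γ o (a, z.2.2))).mul_left (Fintype.card Λ : ℝ)⁻¹
      simpa using h

/-- The lamps away from the points visited at a resampled time are determined by the data. -/
theorem lampKernel_left_eq (l : List (NoisyLetter Λ Γ)) {y y' : PermWreath Λ X G}
    (hy : lampKernel γ o l y ≠ 0) (hy' : lampKernel γ o l y' ≠ 0) {x : X}
    (hx : x ∉ resampled γ o (l.map NoisyLetter.marked)) : y.left.1 x = y'.left.1 x := by
  induction l generalizing y y' x with
  | nil =>
    have h : ∀ y : PermWreath Λ X G, lampKernel γ o [] y ≠ 0 → y = 1 := fun y hy => by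
      by_contra h
      exact hy (if_neg h)
    rw [h y hy, h y' hy']
  | cons z l ih =>
    rw [List.map_cons, mem_resampled_cons] at hx
    push Not at hx
    obtain ⟨hxo, hx⟩ := hx
    rcases hz : z.1 with _ | _
    · simp only [lampKernel, hz, Bool.false_eq_true, if_false] at hy hy'
      simp only [NoisyLetter.marked, hz, Bool.false_eq_true, if_false] at hx
      rw [left_apply_eq γ o z.2.1 y, left_apply_eq γ o z.2.1 y', ih hy hy' hx]
    · simp only [lampKernel, hz, if_true] at hy hy'
      simp only [NoisyLetter.marked, hz, if_true, ne_eq, true_imp_iff] at hx hxo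
      obtain ⟨a, -, ha⟩ := Finset.exists_ne_zero_of_sum_ne_zero hy
      obtain ⟨a', -, ha'⟩ := Finset.exists_ne_zero_of_sum_ne_zero hy'
      rw [left_apply_eq γ o (a, z.2.2) y, left_apply_eq γ o (a', z.2.2) y',
        ih (right_ne_zero_of_mul ha) (right_ne_zero_of_mul ha') hx, Pi.mulSingle_eq_of_ne hxo,
        Pi.mulSingle_eq_of_ne hxo]

/-- The lamps at the points visited at a resampled time are independent and uniform. -/
theorem lampKernel_le (l : List (NoisyLetter Λ Γ)) (y : PermWreath Λ X G) :
    lampKernel γ o l y ≤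
      (Fintype.card Λ : ℝ)⁻¹ ^ (resampled γ o (l.map NoisyLetter.marked)).card := by
  have hcard : (0 : ℝ) < Fintype.card Λ := by exact_mod_cast Fintype.card_pos
  induction l generalizing y with
  | nil =>
    simp only [lampKernel, List.map_nil, resampled, Finset.card_empty, pow_zero]
    split_ifs <;> norm_num
  | cons z l ih =>
    rw [List.map_cons, card_resampled_cons]
    set B := (Fintype.card Λ : ℝ)⁻¹ ^ (resampled γ o (l.map NoisyLetter.marked)).card with hB
    have hB0 : 0 ≤ B := by positivity
    rcases hz : z.1 with _ | _
    · simpa only [lampKernel, NoisyLetter.marked, hz, Bool.false_eq_true, if_false, false_and,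
        add_zero] using ih _
    · simp only [lampKernel, NoisyLetter.marked, hz, if_true, true_and]
      rw [← Finset.mul_sum]
      split_ifs with h
      · rw [add_zero, inv_mul_le_iff₀ hcard]
        have := Finset.sum_le_card_nsmul Finset.univ
          (fun a => lampKernel γ o l ((switchStep γ o (a, z.2.2))⁻¹ * y)) B fun a _ => ih _
        rwa [Finset.card_univ, nsmul_eq_mul] at this
      · rw [pow_succ, mul_comm]
        refine mul_le_mul_of_nonneg_right ?_ (by positivity)
        -- Here `o` is a new resampled point. The lamp of `y` at `o` is `a` times a lamp of the
        -- remainder that the data determine, as it sits at a point not resampled before. So at most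
        -- one `a` contributes, and the factor `1 / |Λ|` is gained.
        by_cases h0 : ∀ a, lampKernel γ o l ((switchStep γ o (a, z.2.2))⁻¹ * y) = 0
        · rw [Finset.sum_eq_zero fun a _ => h0 a]
          exact hB0
        · push Not at h0
          obtain ⟨a, ha⟩ := h0
          rw [Finset.sum_eq_single a]
          · exact ih _
          · intro b _ hba
            by_contra hb
            have h1 := left_apply_eq γ o (a, z.2.2) y o
            rw [left_apply_eq γ o (b, z.2.2) y o, lampKernel_left_eq γ o l hb ha h] at h1
            simp only [Pi.mulSingle_eq_same] at h1
            exact hba (mul_right_cancel h1)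
          · exact fun h => absurd (Finset.mem_univ _) h

variable [Fintype Γ] {p : Γ → ℝ}

variable (p) in
/-- The law of a noisy letter. -/
noncomputable def noisyLetterLaw (ρ : ℝ) (z : NoisyLetter Λ Γ) : ℝ :=
  (if z.1 then ρ else 1 - ρ) * ((Fintype.card Λ : ℝ)⁻¹ * p z.2.1.2) * p z.2.2

/-- The group part actually used by `Yₙ` has law `p` and is independent of the mark, whether it is
the old one or the fresh one. -/
theorem noisyLetterLaw_marked (hp1 : ∑ c, p c = 1) (ρ : ℝ) (F : Bool × Γ → ℝ) :
    ∑ z : NoisyLetter Λ Γ, noisyLetterLaw p ρ z * F z.marked =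
      ∑ e, markedLaw p ρ e * F e := by
  have hcard : (Fintype.card Λ : ℝ) ≠ 0 := by exact_mod_cast Fintype.card_ne_zero
  have h1 : ∀ a : Λ × Γ, ∑ c, ρ * ((Fintype.card Λ : ℝ)⁻¹ * p a.2) * p c * F (true, c) =
      ((Fintype.card Λ : ℝ)⁻¹ * p a.2) * ∑ c, ρ * p c * F (true, c) := fun a => by
    rw [Finset.mul_sum]
    exact Finset.sum_congr rfl fun c _ => by ring
  have h2 : ∀ a : Λ × Γ,
      ∑ c, (1 - ρ) * ((Fintype.card Λ : ℝ)⁻¹ * p a.2) * p c * F (false, a.2) =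
        (1 - ρ) * ((Fintype.card Λ : ℝ)⁻¹ * p a.2) * F (false, a.2) := fun a => by
    rw [← Finset.sum_mul, ← Finset.mul_sum, hp1, mul_one]
  rw [Fintype.sum_prod_type, Fintype.sum_prod_type, Fintype.sum_bool, Fintype.sum_bool]
  simp only [Fintype.sum_prod_type (α₁ := Λ × Γ), noisyLetterLaw, markedLaw, NoisyLetter.marked,
    if_true, Bool.false_eq_true, if_false, h1, h2]
  rw [← Finset.sum_mul]
  simp only [Fintype.sum_prod_type, ← Finset.mul_sum, hp1, Finset.sum_const, Finset.card_univ,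
    nsmul_eq_mul]
  congr 1
  · field_simp
  · rw [Finset.mul_sum]
    refine Finset.sum_congr rfl fun c _ => ?_
    field_simp

/-- Disintegration of the joint law: the noisy letters determine `Xₙ` and leave for `Yₙ` the law
`lampKernel`. It follows by peeling off the first letter. -/
theorem noisyWalkLaw_switchStep (hp1 : ∑ c, p c = 1) (q : PMF (Λ × Γ))
    (hq : ∀ a, (q a).toReal = (Fintype.card Λ : ℝ)⁻¹ * p a.2) (ρ : unitInterval) (n : ℕ)
    (x y : PermWreath Λ X G) :
    (noisyWalkLaw (q.map (switchStep γ o)) ρ n (x, y)).toReal =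
      pathSum (noisyLetterLaw p (ρ : ℝ)) n fun l =>
        (if (l.map fun z => switchStep γ o z.2.1).prod = x then 1 else 0) *
          lampKernel γ o l y := by
  induction n generalizing x y with
  | zero =>
    simp only [noisyWalkLaw, walkLaw, pathSum, List.map_nil, List.prod_nil, PMF.pure_apply,
      lampKernel, Prod.ext_iff, Prod.fst_one, Prod.snd_one]
    by_cases hx : x = 1 <;> by_cases hy : y = 1 <;> simp [hx, hy, eq_comm]
  | succ n ih =>
    rw [noisyWalkLaw_succ_toReal]
    simp only [ih, hq, pathSum]
    rw [Fintype.sum_prod_type (α₁ := Bool), Fintype.sum_bool]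
    simp only [Fintype.sum_prod_type (α₁ := Λ × Γ), List.map_cons, List.prod_cons, lampKernel,
      noisyLetterLaw, if_true, Bool.false_eq_true, if_false, ← eq_inv_mul_iff_mul_eq]
    rw [← Finset.sum_add_distrib]
    refine Finset.sum_congr rfl fun a _ => ?_
    have hsum : ∀ c, (pathSum (noisyLetterLaw p (ρ : ℝ)) n fun l =>
        (if (l.map fun z => switchStep γ o z.2.1).prod = (switchStep γ o a)⁻¹ * x
          then 1 else 0) * ∑ b, (Fintype.card Λ : ℝ)⁻¹ *
            lampKernel γ o l ((switchStep γ o (b, c))⁻¹ * y)) =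
        ∑ b, (Fintype.card Λ : ℝ)⁻¹ * pathSum (noisyLetterLaw p (ρ : ℝ)) n fun l =>
          (if (l.map fun z => switchStep γ o z.2.1).prod = (switchStep γ o a)⁻¹ * x
            then 1 else 0) * lampKernel γ o l ((switchStep γ o (b, c))⁻¹ * y) := fun c => by
      simp only [← pathSum_const_mul, ← pathSum_sum, Finset.mul_sum, mul_left_comm]
    -- A fresh group part is drawn at unmarked times too, and is ignored there; its law sums to one.
    have hconst : ∀ K C : ℝ, ∑ c, K * p c * C = K * C := fun K C => by
      rw [← Finset.sum_mul, ← Finset.mul_sum, hp1, mul_one]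
    simp only [hsum]
    rw [Fintype.sum_prod_type_right, mul_add, add_comm, Finset.mul_sum, Finset.mul_sum]
    congr 1
    · refine Finset.sum_congr rfl fun c _ => ?_
      simp only [Finset.mul_sum]
      exact Finset.sum_congr rfl fun b _ => by ring
    · rw [← mul_assoc, ← hconst]
      refine Finset.sum_congr rfl fun c _ => ?_
      rw [mul_comm (1 - (ρ : ℝ))]

/-- The conditional entropy of the noisy switch-walk given the switch-walk is at least the mean
entropy of the lamps at the points visited at a resampled time. -/
theorem resampled_le_conditionalEntropy (hp : ∀ c, 0 ≤ p c) (hp1 : ∑ c, p c = 1)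
    (q : PMF (Λ × Γ)) (hq : ∀ a, (q a).toReal = (Fintype.card Λ : ℝ)⁻¹ * p a.2)
    (ρ : unitInterval) (n : ℕ) :
    Real.log (Fintype.card Λ) *
        (pathSum (markedLaw p (ρ : ℝ)) n fun l => ((resampled γ o l).card : ℝ)) ≤
      conditionalEntropy (noisyWalkLaw (q.map (switchStep γ o)) ρ n) := by
  have hcard : (0 : ℝ) < Fintype.card Λ := by exact_mod_cast Fintype.card_pos
  rw [← pathSum_const_mul, ← pathSum_map (noisyLetterLaw p (ρ : ℝ)) (markedLaw p (ρ : ℝ))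
    NoisyLetter.marked (noisyLetterLaw_marked (Λ := Λ) hp1 (ρ : ℝ)) n, pathSum_eq_sum]
  have hz : ∀ z : NoisyLetter Λ Γ, 0 ≤ noisyLetterLaw p (ρ : ℝ) z := fun z =>
    mul_nonneg (mul_nonneg (by split_ifs; exacts [ρ.2.1, sub_nonneg.2 ρ.2.2])
      (mul_nonneg (by positivity) (hp _))) (hp _)
  refine sum_le_conditionalEntropy _ (fun ω => Finset.prod_nonneg fun i _ => hz _)
    (fun ω : Fin n → NoisyLetter Λ Γ =>
      ((List.ofFn ω).map fun z => switchStep γ o z.2.1).prod)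
    (fun ω => lampKernel γ o (List.ofFn ω)) _ (fun x y => ?_) (fun ω => lampKernel_nonneg γ o _)
    (fun ω => lampKernel_support_finite γ o _) (fun ω => lampKernel_hasSum γ o _) fun ω y => ?_
  · rw [noisyWalkLaw_switchStep γ o hp1 q hq, pathSum_eq_sum]
    congr!
  · refine (lampKernel_le γ o _ y).trans (le_of_eq ?_)
    rw [mul_comm, ← mul_neg, ← Real.log_inv, Real.exp_nat_mul, Real.exp_log (by positivity)]

end SwitchWalks

/-! ## Sections of tree automorphisms -/

namespace TreeAut

variable {d : DegreeSeq}

theorem apply_cons (g : TreeAut d) (a : Fin (d.deg 0)) (y : Boundary d.shift) :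
    g.1 (cons a y) = cons (rootPerm g a) ((sect g a).1 y) := by
  rw [← apply_cons_zero g a y]
  exact (cons_tail _).symm

theorem cons_inj {a b : Fin (d.deg 0)} {y z : Boundary d.shift} :
    cons a y = cons b z ↔ a = b ∧ y = z :=
  ⟨fun h => ⟨congrFun h 0, congrArg tail h⟩, fun h => by rw [h.1, h.2]⟩

theorem cons_injective (a : Fin (d.deg 0)) : Function.Injective (cons (d := d) a) :=
  fun _ _ h => (cons_inj.1 h).2

theorem cons_first : cons (d.first 0) (leftmostRay d.shift) = leftmostRay d :=
  cons_tail (leftmostRay d)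

theorem apply_zero (g : TreeAut d) (x : Boundary d) : g.1 x 0 = rootPerm g (x 0) := by
  rw [← apply_cons_zero g (x 0) (tail x), cons_tail]

theorem sect_one (a : Fin (d.deg 0)) : sect (1 : TreeAut d) a = 1 :=
  Subtype.ext (Equiv.ext fun _ => rfl)

theorem mul_apply (g h : TreeAut d) (x : Boundary d) : (g * h).1 x = g.1 (h.1 x) := rfl

theorem inv_apply_eq {g : TreeAut d} {x y : Boundary d} : g⁻¹.1 x = y ↔ x = g.1 y :=
  Equiv.symm_apply_eq g.1

theorem rootPerm_mul (g h : TreeAut d) : rootPerm (g * h) = rootPerm g * rootPerm h := by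
  ext a
  have := congrFun (congrArg g.1 (apply_cons h a (leftmostRay d.shift))) 0
  rw [apply_cons_zero g] at this
  exact congrArg Fin.val this

theorem sect_mul (g h : TreeAut d) (a : Fin (d.deg 0)) :
    sect (g * h) a = sect g (rootPerm h a) * sect h a := by
  refine Subtype.ext (Equiv.ext fun y => ?_)
  have h1 := apply_cons (g * h) a y
  rw [mul_apply, apply_cons, apply_cons] at h1
  exact (cons_inj.1 h1).2.symm

theorem ext_sect {g h : TreeAut d} (h1 : rootPerm g = rootPerm h)
    (h2 : ∀ a, sect g a = sect h a) : g = h := by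
  refine Subtype.ext (Equiv.ext fun x => ?_)
  rw [← cons_tail x, apply_cons, apply_cons, h1, h2]

theorem IsRooted.apply_cons {g : TreeAut d} (hg : IsRooted g) (a : Fin (d.deg 0))
    (y : Boundary d.shift) : g.1 (cons a y) = cons (rootPerm g a) y := by
  rw [TreeAut.apply_cons, hg a]
  rfl

theorem IsRooted.one : IsRooted (1 : TreeAut d) := sect_one

theorem IsRooted.mul {g h : TreeAut d} (hg : IsRooted g) (hh : IsRooted h) :
    IsRooted (g * h) := fun a => by rw [sect_mul, hg, hh, mul_one]

theorem IsDirected.rootPerm_first {g : TreeAut d} (hg : IsDirected g) :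
    rootPerm g (d.first 0) = d.first 0 := (hg 0).1

theorem IsDirected.isRooted_sect {g : TreeAut d} (hg : IsDirected g) {a : Fin (d.deg 0)}
    (ha : a ≠ d.first 0) : IsRooted (sect g a) := (hg 0).2 a ha

theorem IsDirected.sect_first {g : TreeAut d} (hg : IsDirected g) :
    IsDirected (sect g (d.first 0)) := fun k => hg (k + 1)

theorem IsDirected.apply_leftmostRay {g : TreeAut d} (hg : IsDirected g) :
    g.1 (leftmostRay d) = leftmostRay d := by
  funext k
  induction k generalizing d with
  | zero => rw [apply_zero]; exact hg.rootPerm_first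
  | succ k ih =>
    rw [← cons_first, TreeAut.apply_cons]
    exact ih hg.sect_first

/-- The section of `g` that arrives at the first-level vertex `a`. -/
def outSect (g : TreeAut d) (a : Fin (d.deg 0)) : TreeAut d.shift :=
  sect g ((rootPerm g).symm a)

theorem inv_apply_cons (g : TreeAut d) (a : Fin (d.deg 0)) (y : Boundary d.shift) :
    g⁻¹.1 (cons a y) = cons ((rootPerm g).symm a) ((outSect g a)⁻¹.1 y) := by
  rw [inv_apply_eq, apply_cons, Equiv.apply_symm_apply]
  exact congrArg _ ((outSect g a).1.apply_symm_apply y).symm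

theorem outSect_mul (g h : TreeAut d) (a : Fin (d.deg 0)) :
    outSect (g * h) a = outSect g a * outSect h ((rootPerm g).symm a) := by
  rw [outSect, sect_mul, rootPerm_mul]
  change sect g (rootPerm h ((rootPerm h).symm ((rootPerm g).symm a))) * _ = _
  rw [Equiv.apply_symm_apply]
  rfl

theorem outSect_one (a : Fin (d.deg 0)) : outSect (1 : TreeAut d) a = 1 := sect_one _

theorem IsRooted.outSect {g : TreeAut d} (hg : IsRooted g) (a : Fin (d.deg 0)) :
    outSect g a = 1 := hg _

theorem ext_outSect {g h : TreeAut d} (h1 : rootPerm g = rootPerm h)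
    (h2 : ∀ a, outSect g a = outSect h a) : g = h :=
  ext_sect h1 fun a => by simpa [outSect, h1] using h2 (rootPerm h a)

theorem IsDirected.symm_first {g : TreeAut d} (hg : IsDirected g) :
    (rootPerm g).symm (d.first 0) = d.first 0 :=
  (Equiv.symm_apply_eq _).2 hg.rootPerm_first.symm

theorem IsDirected.symm_ne_first {g : TreeAut d} (hg : IsDirected g) {a : Fin (d.deg 0)}
    (ha : a ≠ d.first 0) : (rootPerm g).symm a ≠ d.first 0 := fun h =>
  ha (by rw [(Equiv.symm_apply_eq _).1 h, hg.rootPerm_first])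

theorem IsDirected.isRooted_outSect {g : TreeAut d} (hg : IsDirected g) {a : Fin (d.deg 0)}
    (ha : a ≠ d.first 0) : IsRooted (TreeAut.outSect g a) :=
  hg.isRooted_sect (hg.symm_ne_first ha)

theorem IsDirected.outSect_first {g : TreeAut d} (hg : IsDirected g) :
    TreeAut.outSect g (d.first 0) = sect g (d.first 0) := by
  rw [TreeAut.outSect, hg.symm_first]

variable {I : Type*}

/-- The sections at the leftmost vertex of the first level. -/
def firstSects (θ : I → TreeAut d) (i : I) : TreeAut d.shift := sect (θ i) (d.first 0)

/-- A multiplicative family of directed automorphisms. -/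
structure DirectedFamily [Mul I] (θ : I → TreeAut d) : Prop where
  directed : ∀ i, IsDirected (θ i)
  map_mul : ∀ i j, θ (i * j) = θ i * θ j

theorem DirectedFamily.firstSects [Mul I] {θ : I → TreeAut d} (hθ : DirectedFamily θ) :
    DirectedFamily (firstSects θ) where
  directed i := (hθ.directed i).sect_first
  map_mul i j := by
    rw [TreeAut.firstSects, hθ.map_mul, sect_mul, (hθ.directed j).rootPerm_first]
    rfl

end TreeAut

/-! ## Description of lamps and automorphisms by visited points -/

namespace TreeAut

open scoped Classical

variable {d : DegreeSeq} {I Λ : Type*} [Group Λ]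

/-- The lamp configuration `φ` and the automorphism `g` are obtained by a word in rooted
automorphisms and letters `δ_l (θ i)`, with set `R` of visited points. -/
inductive Reach (θ : I → TreeAut d) :
    Finset (Boundary d) → (Boundary d → Λ) → TreeAut d → Prop
  | nil : Reach θ ∅ 1 1
  | rooted {s : TreeAut d} (hs : IsRooted s) {R : Finset (Boundary d)} {φ : Boundary d → Λ}
      {g : TreeAut d} : Reach θ R φ g →
      Reach θ (R.image s.1) (fun x => φ (s⁻¹.1 x)) (s * g)
  | directed (i : I) (a : Λ) {R : Finset (Boundary d)} {φ : Boundary d → Λ} {g : TreeAut d} :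
      Reach θ R φ g → Reach θ (insert (leftmostRay d) (R.image (θ i).1))
        (fun x => (Pi.mulSingle (leftmostRay d) a : Boundary d → Λ) x * φ ((θ i)⁻¹.1 x))
        (θ i * g)

/-- The rays of `R` through the first-level vertex `a`, seen in the subtree below it. -/
noncomputable def subrays (R : Finset (Boundary d)) (a : Fin (d.deg 0)) :
    Finset (Boundary d.shift) := R.preimage (cons a) (cons_injective a).injOn

theorem mem_subrays {R : Finset (Boundary d)} {a : Fin (d.deg 0)} {y : Boundary d.shift} :
    y ∈ subrays R a ↔ cons a y ∈ R := Finset.mem_preimage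

theorem mem_image_apply {g : TreeAut d} {R : Finset (Boundary d)} {x : Boundary d} :
    x ∈ R.image g.1 ↔ g⁻¹.1 x ∈ R := by
  rw [Finset.mem_image]
  constructor
  · rintro ⟨y, hy, rfl⟩
    rwa [inv_apply_eq.2 rfl]
  · exact fun h => ⟨_, h, g.1.apply_symm_apply x⟩

theorem sum_card_subrays (R : Finset (Boundary d)) :
    ∑ a, (subrays R a).card = R.card := by
  rw [Finset.card_eq_sum_card_fiberwise (f := fun x : Boundary d => x 0) (t := Finset.univ)
    fun _ _ => Finset.mem_coe.2 (Finset.mem_univ _)]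
  refine Finset.sum_congr rfl fun a _ => ?_
  rw [← Finset.card_image_of_injective (subrays R a) (cons_injective a)]
  congr 1
  ext x
  rw [Finset.mem_image, Finset.mem_filter]
  constructor
  · rintro ⟨y, hy, rfl⟩
    exact ⟨mem_subrays.1 hy, rfl⟩
  · rintro ⟨hx, rfl⟩
    exact ⟨tail x, mem_subrays.2 (by rwa [cons_tail]), cons_tail x⟩

theorem mulSingle_cons_first (a : Λ) (y : Boundary d.shift) :
    (Pi.mulSingle (leftmostRay d) a : Boundary d → Λ) (cons (d.first 0) y) =
      (Pi.mulSingle (leftmostRay d.shift) a : Boundary d.shift → Λ) y := by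
  rw [Pi.mulSingle_apply, Pi.mulSingle_apply, ← cons_first]
  simp only [cons_inj, true_and]

theorem mulSingle_cons_of_ne (a : Λ) {b : Fin (d.deg 0)} (hb : b ≠ d.first 0)
    (y : Boundary d.shift) :
    (Pi.mulSingle (leftmostRay d) a : Boundary d → Λ) (cons b y) = 1 := by
  have h : cons b y ≠ leftmostRay d := fun h => hb (congrFun h 0)
  rw [Pi.mulSingle_apply, if_neg h]

/-- A rooted letter only permutes the first-level subtrees. A letter `δ_l (θ i)` acts as the letter
`δ_l (firstSects θ i)` in the leftmost subtree, and as a rooted letter without lamp in every other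
one. -/
theorem Reach.sect [Mul I] {θ : I → TreeAut d} (hθ : DirectedFamily θ) {R : Finset (Boundary d)}
    {φ : Boundary d → Λ} {g : TreeAut d} (h : Reach θ R φ g) (a : Fin (d.deg 0)) :
    Reach (firstSects θ) (subrays R a) (fun y => φ (cons a y)) (outSect g a) := by
  induction h generalizing a with
  | nil =>
    rw [outSect_one, show subrays (∅ : Finset (Boundary d)) a = ∅ from Finset.preimage_empty]
    exact Reach.nil
  | @rooted s hs R φ g h ih =>
    have hinv : ∀ y, s⁻¹.1 (cons a y) = cons ((rootPerm s).symm a) y := fun y => by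
      rw [inv_apply_cons, hs.outSect]
      rfl
    have hR : subrays (R.image s.1) a = subrays R ((rootPerm s).symm a) := by
      ext y
      rw [mem_subrays, mem_image_apply, hinv, mem_subrays]
    rw [hR, outSect_mul, hs.outSect, one_mul]
    simp only [hinv]
    exact ih _
  | @directed i l R φ g h ih =>
    have hi := hθ.directed i
    by_cases ha : a = d.first 0
    · subst ha
      have hinv : ∀ y, (θ i)⁻¹.1 (cons (d.first 0) y) =
          cons (d.first 0) ((firstSects θ i)⁻¹.1 y) := fun y => by
        rw [inv_apply_cons, hi.symm_first, hi.outSect_first]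
        rfl
      have hR : subrays (insert (leftmostRay d) (R.image (θ i).1)) (d.first 0) =
          insert (leftmostRay d.shift)
            ((subrays R (d.first 0)).image (firstSects θ i).1) := by
        ext y
        rw [mem_subrays, Finset.mem_insert, Finset.mem_insert, mem_image_apply, mem_image_apply,
          hinv, mem_subrays, ← cons_first, cons_inj, and_iff_right rfl]
      rw [hR, outSect_mul, hi.outSect_first, hi.symm_first]
      simp only [hinv, mulSingle_cons_first]
      exact Reach.directed i l (ih _)
    · have hs := hi.isRooted_outSect ha
      have hR : subrays (insert (leftmostRay d) (R.image (θ i).1)) a =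
          (subrays R ((rootPerm (θ i)).symm a)).image (outSect (θ i) a).1 := by
        ext y
        rw [mem_subrays, Finset.mem_insert, mem_image_apply, mem_image_apply, inv_apply_cons,
          mem_subrays, or_iff_right]
        exact fun h => ha (congrFun h 0)
      rw [hR, outSect_mul]
      simp only [inv_apply_cons, mulSingle_cons_of_ne l ha, one_mul]
      exact Reach.rooted hs (ih _)

/-- The three types of words, according to the first-level vertices that contain visited points:
there are none, or there is a single visited point, or there are several of them. -/
theorem Reach.cases_card [Mul I] {θ : I → TreeAut d} (hθ : DirectedFamily θ)
    {R : Finset (Boundary d)} {φ : Boundary d → Λ} {g : TreeAut d} (h : Reach θ R φ g) :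
    (R = ∅ ∧ φ = 1 ∧ IsRooted g) ∨
    (∃ a, R = {cons a (leftmostRay d.shift)} ∧
      (∀ x, x ≠ cons a (leftmostRay d.shift) → φ x = 1) ∧
      (∃ i, outSect g a = firstSects θ i) ∧ ∀ b, b ≠ a → IsRooted (outSect g b)) ∨
    ∃ x ∈ R, ∃ y ∈ R, x 0 ≠ y 0 := by
  have hne : ∀ (k : TreeAut d) {x y : Boundary d}, x 0 ≠ y 0 → k.1 x 0 ≠ k.1 y 0 :=
    fun k x y hxy h => by
      rw [apply_zero, apply_zero] at h
      exact hxy ((rootPerm k).injective h)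
  induction h with
  | nil => exact Or.inl ⟨rfl, rfl, IsRooted.one⟩
  | @rooted s hs R φ g h ih =>
    rcases ih with ⟨rfl, rfl, hg⟩ | ⟨a, rfl, hφ, ⟨i, hi⟩, hg⟩ | ⟨x, hx, y, hy, hxy⟩
    · exact Or.inl ⟨Finset.image_empty _, rfl, hs.mul hg⟩
    · refine Or.inr (Or.inl ⟨rootPerm s a, ?_, fun x hx => hφ _ fun h => hx ?_, ⟨i, ?_⟩,
        fun b hb => ?_⟩)
      · rw [Finset.image_singleton, hs.apply_cons]
      · rw [inv_apply_eq.1 h, hs.apply_cons]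
      · rw [outSect_mul, hs.outSect, one_mul, Equiv.symm_apply_apply, hi]
      · rw [outSect_mul, hs.outSect, one_mul]
        exact hg _ fun h => hb ((Equiv.symm_apply_eq _).1 h)
    · exact Or.inr (Or.inr ⟨_, Finset.mem_image_of_mem _ hx, _, Finset.mem_image_of_mem _ hy,
        hne s hxy⟩)
  | @directed i l R φ g h ih =>
    have hi := hθ.directed i
    rcases ih with ⟨rfl, rfl, hg⟩ | ⟨a, rfl, hφ, ⟨j, hj⟩, hg⟩ | ⟨x, hx, y, hy, hxy⟩
    · refine Or.inr (Or.inl ⟨d.first 0, ?_, fun x hx => ?_, ⟨i, ?_⟩, fun b hb => ?_⟩)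
      · rw [Finset.image_empty, cons_first]
        rfl
      · rw [cons_first] at hx
        dsimp only
        rw [Pi.mulSingle_eq_of_ne hx, one_mul]
        rfl
      · rw [outSect_mul, hg.outSect, mul_one, hi.outSect_first]
        rfl
      · rw [outSect_mul, hg.outSect, mul_one]
        exact hi.isRooted_outSect hb
    · by_cases ha : a = d.first 0
      · subst ha
        rw [cons_first] at hφ
        -- The only visited point is `1^∞`, which `θ i` fixes. The two directed sections merge into
        -- a single one because the family is multiplicative.
        refine Or.inr (Or.inl ⟨d.first 0, ?_, fun x hx => ?_, ⟨i * j, ?_⟩, fun b hb => ?_⟩)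
        · rw [Finset.image_singleton, cons_first, hi.apply_leftmostRay]
          exact Finset.insert_eq_of_mem (Finset.mem_singleton_self _)
        · rw [cons_first] at hx
          dsimp only
          rw [Pi.mulSingle_eq_of_ne hx, one_mul, hφ]
          exact fun h => hx (by rw [inv_apply_eq.1 h, hi.apply_leftmostRay])
        · rw [outSect_mul, hi.symm_first, hj, hi.outSect_first, hθ.firstSects.map_mul]
          rfl
        · rw [outSect_mul]
          exact (hi.isRooted_outSect hb).mul (hg _ (hi.symm_ne_first hb))
      -- The old point lies off the leftmost subtree and stays off it, while `1^∞` is added: two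
      -- first-level vertices are now occupied, which no later automorphism can undo.
      · refine Or.inr (Or.inr ⟨_, Finset.mem_insert_self _ _, _,
          Finset.mem_insert_of_mem (Finset.mem_image_of_mem _ (Finset.mem_singleton_self _)), ?_⟩)
        rw [← hi.apply_leftmostRay]
        exact hne _ (Ne.symm ha)
    · exact Or.inr (Or.inr ⟨_, Finset.mem_insert_of_mem (Finset.mem_image_of_mem _ hx), _,
        Finset.mem_insert_of_mem (Finset.mem_image_of_mem _ hy), hne _ hxy⟩)

end TreeAut

/-! ## A subprobability weight that charges the values of words with few visited points -/

theorem ENNReal.tsum_prod_fin {X : Type*} (w : X → ENNReal) (n : ℕ) :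
    ∑' f : Fin n → X, ∏ i, w (f i) = (∑' x, w x) ^ n := by
  induction n with
  | zero => simp
  | succ n ih =>
    rw [← (Fin.consEquiv fun _ => X).tsum_eq, ENNReal.tsum_prod']
    simp only [Fin.consEquiv, Equiv.coe_fn_mk, Fin.prod_univ_succ, Fin.cons_zero, Fin.cons_succ,
      ENNReal.tsum_mul_left, ih, ENNReal.tsum_mul_right]
    rw [pow_succ']

namespace TreeAut

open scoped Classical

variable {I Λ : Type*} [Group Λ]

/-- The values of words that have no letter `δ_l (θ i)`, or no other letters. -/
def IsSimple {d : DegreeSeq} (θ : I → TreeAut d) (x : (Boundary d → Λ) × TreeAut d) : Prop :=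
  (x.1 = 1 ∧ IsRooted x.2) ∨ ((∀ y, y ≠ leftmostRay d → x.1 y = 1) ∧ ∃ i, x.2 = θ i)

/-- The section over the first-level vertex `a` of a lamp configuration and an automorphism. -/
def sectionAt {d : DegreeSeq} (x : (Boundary d → Λ) × TreeAut d) (a : Fin (d.deg 0)) :
    (Boundary d.shift → Λ) × TreeAut d.shift :=
  (fun y => x.1 (cons a y), outSect x.2 a)

/-- The weight of the descriptions of depth at most `M` of `x` by nested sections, where each
node that is not simple has weight `z`. -/
noncomputable def weight (z : ENNReal) :
    ℕ → {d : DegreeSeq} → (I → TreeAut d) → (Boundary d → Λ) × TreeAut d → ENNReal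
  | 0, _, θ, x => if IsSimple θ x then 1 else 0
  | M + 1, _, θ, x =>
    (if IsSimple θ x then 1 else 0) + z * ∏ a, weight z M (firstSects θ) (sectionAt x a)

theorem IsSimple.one_le_weight {d : DegreeSeq} {θ : I → TreeAut d}
    {x : (Boundary d → Λ) × TreeAut d} (hx : IsSimple θ x) (z : ENNReal) (M : ℕ) :
    1 ≤ weight z M θ x := by
  cases M with
  | zero => rw [weight, if_pos hx]
  | succ M => rw [weight, if_pos hx]; exact le_self_add

/-- A simple value is coded by its root permutation if it is rooted without lamps, and otherwise by
its lamp at `1^∞` and an index in `I`. The same `I` serves at every level, so the bound does not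
deteriorate with depth. -/
theorem tsum_isSimple_le [Fintype I] [Fintype Λ] {d : DegreeSeq} (θ : I → TreeAut d) :
    ∑' x : (Boundary d → Λ) × TreeAut d, (if IsSimple θ x then (1 : ENNReal) else 0) ≤
      (d.deg 0).factorial + Fintype.card Λ * Fintype.card I := by
  have h1 : ∑' x : (Boundary d → Λ) × TreeAut d, (if IsSimple θ x then (1 : ENNReal) else 0) =
      ∑' _ : {x : (Boundary d → Λ) × TreeAut d | IsSimple θ x}, 1 := by
    rw [tsum_subtype {x | IsSimple θ x} fun _ => (1 : ENNReal)]
    rfl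
  let code : {x : (Boundary d → Λ) × TreeAut d | IsSimple θ x} →
      Equiv.Perm (Fin (d.deg 0)) ⊕ Λ × I := fun x =>
    if h : (∀ y, y ≠ leftmostRay d → x.1.1 y = 1) ∧ ∃ i, x.1.2 = θ i
      then Sum.inr (x.1.1 (leftmostRay d), h.2.choose) else Sum.inl (rootPerm x.1.2)
  have hcode : Function.Injective code := by
    rintro ⟨⟨φ, g⟩, hx⟩ ⟨⟨φ', g'⟩, hx'⟩ h
    simp only [code] at h
    split_ifs at h with h1 h2 h2
    · obtain ⟨ha, hb⟩ := Prod.ext_iff.1 (Sum.inr_injective h)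
      have hg : g = g' := by
        rw [h1.2.choose_spec, h2.2.choose_spec]
        exact congrArg θ hb
      have hφ : φ = φ' := funext fun y => by
        by_cases hy : y = leftmostRay d
        · rw [hy]; exact ha
        · exact (h1.1 y hy).trans (h2.1 y hy).symm
      rw [Subtype.mk.injEq, hg, hφ]
    · obtain ⟨ha, hb⟩ := hx.resolve_right h1
      obtain ⟨ha', hb'⟩ := hx'.resolve_right h2
      have hg : g = g' := ext_sect (Sum.inl_injective h) fun a => (hb a).trans (hb' a).symm
      have hφ : φ = φ' := ha.trans ha'.symm
      rw [Subtype.mk.injEq, hg, hφ]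
  rw [h1]
  refine (ENNReal.tsum_comp_le_tsum_of_injective hcode fun _ => 1).trans (le_of_eq ?_)
  rw [tsum_fintype, Finset.sum_const, Finset.card_univ, Fintype.card_sum, Fintype.card_perm,
    Fintype.card_fin, Fintype.card_prod, nsmul_eq_mul, mul_one]
  push_cast
  rfl

/-- The total mass at depth `M + 1` is at most the number of simple values plus `z D! B^D`, since an
element is determined by its root permutation and its sections. The choice of `z` makes the second
term at most `1`, so `B` reproduces itself. -/
theorem tsum_weight_le [Fintype I] [Fintype Λ] {D : ℕ} {B z : ENNReal}
    (hB : (D.factorial : ENNReal) + Fintype.card Λ * Fintype.card I + 1 ≤ B)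
    (hz : z * (D.factorial * B ^ D) ≤ 1) (M : ℕ) {d : DegreeSeq} (hd : ∀ k, d.deg k ≤ D)
    (θ : I → TreeAut d) :
    ∑' x : (Boundary d → Λ) × TreeAut d, weight z M θ x ≤ B := by
  have hsimple : ∀ {d : DegreeSeq} (_ : ∀ k, d.deg k ≤ D) (θ : I → TreeAut d),
      ∑' x : (Boundary d → Λ) × TreeAut d, (if IsSimple θ x then (1 : ENNReal) else 0) ≤
        D.factorial + Fintype.card Λ * Fintype.card I := fun hd θ =>
    (tsum_isSimple_le θ).trans (add_le_add_left
      (by exact_mod_cast Nat.factorial_le (hd 0)) _)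
  induction M generalizing d with
  | zero => exact (hsimple hd θ).trans (le_self_add.trans hB)
  | succ M ih =>
    have hB1 : 1 ≤ B := le_add_self.trans hB
    let split : (Boundary d → Λ) × TreeAut d →
        Equiv.Perm (Fin (d.deg 0)) × (Fin (d.deg 0) → (Boundary d.shift → Λ) × TreeAut d.shift) :=
      fun x => (rootPerm x.2, sectionAt x)
    have hsplit : Function.Injective split := by
      rintro ⟨φ, g⟩ ⟨φ', g'⟩ h
      obtain ⟨h1, h2⟩ := Prod.ext_iff.1 h
      have hg : g = g' := ext_outSect h1 fun a => congrArg Prod.snd (congrFun h2 a)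
      have hφ : φ = φ' := funext fun y => by
        have := congrFun (congrArg Prod.fst (congrFun h2 (y 0))) (tail y)
        simpa only [sectionAt, split, cons_tail] using this
      rw [hg, hφ]
    have hprod : ∑' x : (Boundary d → Λ) × TreeAut d,
        ∏ a, weight z M (firstSects θ) (sectionAt x a) ≤ D.factorial * B ^ D := by
      refine (ENNReal.tsum_comp_le_tsum_of_injective hsplit
        fun u => ∏ a, weight z M (firstSects θ) (u.2 a)).trans ?_
      rw [ENNReal.tsum_prod', tsum_fintype]
      simp only [ENNReal.tsum_prod_fin, Finset.sum_const, Finset.card_univ, Fintype.card_perm,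
        Fintype.card_fin, nsmul_eq_mul]
      refine mul_le_mul' (by exact_mod_cast Nat.factorial_le (hd 0)) ?_
      exact (pow_le_pow_left' (ih (fun k => hd (k + 1)) _) _).trans
        (pow_le_pow_right₀ hB1 (hd 0))
    simp only [weight]
    rw [ENNReal.tsum_add, ENNReal.tsum_mul_left]
    exact (add_le_add (hsimple hd θ) ((mul_le_mul_right hprod z).trans hz)).trans hB

/-- Induction over the three cases of `Reach.cases_card`. Without visited points the value is simple
(and `2 * 0 - 1 = 0`). With a single occupied vertex, one node has only simple children and costs
`z`. Otherwise the points split among at least two subtrees. -/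
theorem Reach.pow_le_weight [Mul I] {z : ENNReal} (hz : z ≤ 1) (M : ℕ) {d : DegreeSeq}
    {θ : I → TreeAut d} (hθ : DirectedFamily θ) {R : Finset (Boundary d)} {φ : Boundary d → Λ}
    {g : TreeAut d} (h : Reach θ R φ g) (hM : R.card ≤ M) :
    z ^ (2 * R.card - 1) ≤ weight z M θ (φ, g) := by
  induction M generalizing d R φ g with
  | zero =>
    rcases h.cases_card hθ with ⟨rfl, hφ, hg⟩ | ⟨a, rfl, -⟩ | ⟨x, hx, -⟩
    · exact (pow_le_one' hz _).trans (IsSimple.one_le_weight (Or.inl ⟨hφ, hg⟩) z 0)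
    · simp at hM
    · rw [Finset.card_eq_zero.1 (Nat.le_zero.1 hM)] at hx
      exact absurd hx (Finset.notMem_empty _)
  | succ M ih =>
    rcases h.cases_card hθ with ⟨rfl, hφ, hg⟩ | ⟨a, rfl, hφ, hi, hg⟩ | ⟨x, hx, y, hy, hxy⟩
    · exact (pow_le_one' hz _).trans (IsSimple.one_le_weight (Or.inl ⟨hφ, hg⟩) z _)
    · rw [Finset.card_singleton, weight]
      refine le_trans ?_ le_add_self
      rw [show 2 * 1 - 1 = 1 from rfl, pow_one]
      refine le_mul_of_one_le_right' (Finset.one_le_prod' fun b _ => IsSimple.one_le_weight ?_ z M)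
      by_cases hb : b = a
      · subst hb
        exact Or.inr ⟨fun y hy => hφ _ fun h => hy (cons_inj.1 h).2, hi⟩
      · exact Or.inl ⟨funext fun y => hφ _ fun h => hb (cons_inj.1 h).1, hg b hb⟩
    · have hpos : ∀ x ∈ R, 1 ≤ (subrays R (x 0)).card := fun x hx =>
        Finset.card_pos.2 ⟨tail x, mem_subrays.2 (by rwa [cons_tail])⟩
      -- Another vertex is also occupied, so each subtree has strictly fewer points and the depth
      -- `M` suffices for the recursion.
      have hlt : ∀ a, (subrays R a).card < R.card := fun a => by
        obtain ⟨b, hb, hba⟩ : ∃ b, 1 ≤ (subrays R b).card ∧ b ≠ a := by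
          by_cases hxa : x 0 = a
          · exact ⟨y 0, hpos y hy, fun h => hxy (hxa.trans h.symm)⟩
          · exact ⟨x 0, hpos x hx, hxa⟩
        rw [← sum_card_subrays R]
        exact Finset.single_lt_sum (f := fun c => (subrays R c).card) hba (Finset.mem_univ a) (Finset.mem_univ b) hb
          fun _ _ _ => Nat.zero_le _
      -- Each of the two occupied vertices `x 0` and `y 0` saves one unit from `2 * R.card`: one
      -- pays for the present node, the other is the final `- 1`. Truncated subtraction gives empty
      -- subtrees the exponent `0`.
      have hexp : 1 + ∑ a, (2 * (subrays R a).card - 1) ≤ 2 * R.card - 1 := by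
        have hterm : ∀ a, (2 * (subrays R a).card - 1) + ((if a = x 0 then 1 else 0) +
            if a = y 0 then 1 else 0) ≤ 2 * (subrays R a).card := fun a => by
          have hx' := hpos x hx
          have hy' := hpos y hy
          by_cases ha : a = x 0
          · subst ha
            rw [if_pos rfl, if_neg hxy]
            omega
          · rw [if_neg ha]
            by_cases hb : a = y 0
            · subst hb
              rw [if_pos rfl]
              omega
            · rw [if_neg hb]
              omega
        have hsum := Finset.sum_le_sum fun a (_ : a ∈ Finset.univ) => hterm a
        rw [Finset.sum_add_distrib, Finset.sum_add_distrib, Finset.sum_ite_eq' Finset.univ (x 0),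
          Finset.sum_ite_eq' Finset.univ (y 0), if_pos (Finset.mem_univ _),
          if_pos (Finset.mem_univ _), ← Finset.mul_sum, sum_card_subrays] at hsum
        omega
      rw [weight]
      refine le_trans ?_ le_add_self
      refine (pow_le_pow_right_of_le_one' hz hexp).trans ?_
      rw [pow_add, pow_one, ← Finset.prod_pow_eq_pow_sum]
      refine mul_le_mul_right (Finset.prod_le_prod' fun a _ => ?_) z
      exact ih hθ.firstSects (h.sect hθ a) (by have := hlt a; omega)

end TreeAut

/-! ## The entropy of the switch-walk is at most linear in the number of visited points -/

section DirectedSwitchWalk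

open scoped Classical

variable {d : DegreeSeq} {S : Set (TreeAut d)} {H : Subgroup (TreeAut d)}
  {Λ : Type*} [Group Λ]

variable (S H) in
/-- The leftmost ray as a point of its orbit. -/
def basePoint : leftmostOrbit S H := ⟨leftmostRay d, MulAction.mem_orbit_self _⟩

/-- The group element `h s`. -/
def pairStep (c : H × S) : directedGroup S H :=
  ⟨c.1.1, Subgroup.subset_closure (Or.inr c.1.2)⟩ *
    ⟨c.2.1, Subgroup.subset_closure (Or.inl c.2.2)⟩

/-- A lamp configuration on the orbit, extended to all rays. -/
noncomputable def extendLamps (f : finSuppFun Λ (leftmostOrbit S H)) (x : Boundary d) : Λ :=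
  if h : x ∈ MulAction.orbit (directedGroup S H) (leftmostRay d) then f.1 ⟨x, h⟩ else 1

theorem extendLamps_coe (f : finSuppFun Λ (leftmostOrbit S H)) (x : leftmostOrbit S H) :
    extendLamps f x.1 = f.1 x := dif_pos x.2

theorem extendLamps_injective :
    Function.Injective (extendLamps : finSuppFun Λ (leftmostOrbit S H) → Boundary d → Λ) :=
  fun f f' h => Subtype.ext (funext fun x => by
    rw [← extendLamps_coe, h, extendLamps_coe])

theorem card_visited_le {A X G : Type*} [Group G] [MulAction G X] (γ : A → G) (o : X)
    (l : List A) : (visited γ o l).card ≤ l.length := by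
  induction l with
  | nil => exact le_rfl
  | cons c l ih =>
    rw [visited, List.length_cons]
    exact (Finset.card_insert_le _ _).trans
      (Nat.add_le_add_right (Finset.card_image_le.trans ih) 1)

/-- The letter `δ_l h s` is read as the rooted letter `s` followed on its left by `δ_l h`. Lamps and
visited points are carried from the orbit to the whole boundary, since orbits are not preserved by
passing to sections. -/
theorem reach_word (hS : ∀ s ∈ S, TreeAut.IsRooted s) (l : List (Λ × H × S)) :
    TreeAut.Reach (Subtype.val : H → TreeAut d)
      ((visited pairStep (basePoint S H) (l.map Prod.snd)).image Subtype.val)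
      (extendLamps (l.map (switchStep pairStep (basePoint S H))).prod.left)
      (l.map (switchStep pairStep (basePoint S H))).prod.right.1 := by
  induction l with
  | nil =>
    have h : extendLamps (1 : finSuppFun Λ (leftmostOrbit S H)) = 1 := funext fun x => by
      rw [extendLamps]
      split_ifs <;> rfl
    change TreeAut.Reach _ _ (extendLamps (1 : finSuppFun Λ (leftmostOrbit S H))) 1
    rw [h]
    exact TreeAut.Reach.nil
  | cons a l ih =>
    obtain ⟨b, h, s⟩ := a
    have key := TreeAut.Reach.directed (θ := (Subtype.val : H → TreeAut d)) h b
      (TreeAut.Reach.rooted (hS s.1 s.2) ih)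
    have hinv : ∀ x, s.1⁻¹.1 (h.1⁻¹.1 x) = (pairStep (h, s))⁻¹ • x := fun x => by
      rw [pairStep, mul_inv_rev]
      rfl
    convert key using 1
    · ext x
      rw [List.map_cons, visited, Finset.mem_insert, TreeAut.mem_image_apply,
        TreeAut.mem_image_apply, hinv]
      simp only [Finset.mem_image, Finset.mem_insert, exists_eq_or_imp]
      refine or_congr ⟨fun h => h.symm, fun h => h.symm⟩ ⟨?_, ?_⟩
      · rintro ⟨_, ⟨y, hy, rfl⟩, rfl⟩
        exact ⟨y, hy, (inv_smul_smul (pairStep (h, s)) y.1).symm⟩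
      · rintro ⟨y, hy, hxy⟩
        exact ⟨_, ⟨y, hy, rfl⟩, (eq_inv_smul_iff.1 hxy)⟩
    · funext x
      rw [hinv, List.map_cons, List.prod_cons]
      by_cases hx : x ∈ MulAction.orbit (directedGroup S H) (leftmostRay d)
      · have h1 := extendLamps_coe ((switchStep pairStep (basePoint S H) (b, h, s)) *
          (l.map (switchStep pairStep (basePoint S H))).prod).left ⟨x, hx⟩
        have h2 := extendLamps_coe (l.map (switchStep pairStep (basePoint S H))).prod.left
          ((pairStep (h, s))⁻¹ • (⟨x, hx⟩ : leftmostOrbit S H))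
        refine h1.trans (Eq.trans ?_ (congrArg _ h2.symm))
        by_cases hxo : x = leftmostRay d
        · subst hxo
          rw [Pi.mulSingle_eq_same]
          exact switchStep_mul_left_self _ (basePoint S H) _ _
        · rw [Pi.mulSingle_eq_of_ne hxo, one_mul]
          exact switchStep_mul_left_of_ne _ (basePoint S H) _ _ fun h' =>
            hxo (congrArg Subtype.val h')
      · have hx' : (pairStep (h, s))⁻¹ • x ∉
            MulAction.orbit (directedGroup S H) (leftmostRay d) := fun h' => by
          have := MulAction.mem_orbit_of_mem_orbit (pairStep (h, s)) h'
          rw [smul_inv_smul] at this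
          exact hx this
        have hxo : x ≠ leftmostRay d := fun h' => hx (h' ▸ MulAction.mem_orbit_self _)
        rw [extendLamps, dif_neg hx, extendLamps, dif_neg hx', Pi.mulSingle_eq_of_ne hxo, one_mul]
    · rw [List.map_cons, List.prod_cons, switchStep_mul_right]
      exact mul_assoc _ _ _

/-- The data on the boundary of an element of the wreath product. -/
noncomputable def boundaryData (y : DirectedWreath Λ S H) : (Boundary d → Λ) × TreeAut d :=
  (extendLamps y.left, y.right.1)

theorem boundaryData_injective :
    Function.Injective (boundaryData : DirectedWreath Λ S H → (Boundary d → Λ) × TreeAut d) :=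
  fun _ _ h => SemidirectProduct.ext (extendLamps_injective (Prod.ext_iff.1 h).1)
    (Subtype.ext (Prod.ext_iff.1 h).2)

theorem directedFamily_coe (hH : ∀ h ∈ H, TreeAut.IsDirected h) :
    TreeAut.DirectedFamily (Subtype.val : H → TreeAut d) where
  directed h := hH h.1 h.2
  map_mul _ _ := rfl

/-- The entropy of the switch-walk is bounded linearly by the mean number of visited points. -/
theorem exists_shannonEntropy_le [Fintype Λ] [Fintype S] [Fintype H]
    (hS : ∀ s ∈ S, TreeAut.IsRooted s) (hH : ∀ h ∈ H, TreeAut.IsDirected h) {D : ℕ}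
    (hD : ∀ k, d.deg k ≤ D) {p : H × S → ℝ} (hp : ∀ c, 0 ≤ p c) (hp1 : ∑ c, p c = 1)
    (q : PMF (Λ × H × S)) (hq : ∀ a, (q a).toReal = (Fintype.card Λ : ℝ)⁻¹ * p a.2) :
    ∃ C : ℝ, 0 < C ∧ ∀ n : ℕ, 0 < n →
      shannonEntropy (walkLaw (q.map (switchStep pairStep (basePoint S H))) n) ≤
        C * meanVisited pairStep (basePoint S H) p n := by
  -- `B` bounds the simple values plus one, and `z = 1 / K` is chosen so that `z D! B^D = 1`, as
  -- `tsum_weight_le` requires.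
  set B : ℕ := D.factorial + Fintype.card Λ * Fintype.card H + 1 with hB
  set K : ℕ := D.factorial * B ^ D with hK
  have hB1 : 1 ≤ B := Nat.le_add_left _ _
  have hK1 : 1 ≤ K := Nat.mul_pos D.factorial_pos (pow_pos hB1 D)
  set z : ENNReal := (K : ENNReal)⁻¹ with hz
  have hK0 : (K : ENNReal) ≠ 0 := by exact_mod_cast (show K ≠ 0 by omega)
  have hz1 : z ≤ 1 := ENNReal.inv_le_one.2 (by exact_mod_cast hK1)
  have hzr : z.toReal = (K : ℝ)⁻¹ := by rw [hz, ENNReal.toReal_inv, ENNReal.toReal_natCast]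
  have hlogB : 0 ≤ Real.log B := Real.log_natCast_nonneg B
  have hlogK : 0 ≤ Real.log K := Real.log_natCast_nonneg K
  have hKr : (0 : ℝ) < K := by exact_mod_cast hK1
  -- Gibbs gives `log B` plus `2 log K` times the mean number of points; this mean is at least `1`
  -- and absorbs `log B`. The extra `1` only makes the constant positive.
  refine ⟨Real.log B + 2 * Real.log K + 1, by positivity, fun n hn => ?_⟩
  have htsum := TreeAut.tsum_weight_le (Λ := Λ) (B := B) (z := z) (D := D)
    (by rw [hB]; push_cast; exact le_rfl)
    (by
      rw [hz, hK]
      push_cast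
      rw [ENNReal.inv_mul_cancel]
      · simpa [hK] using hK0
      · exact_mod_cast ENNReal.natCast_ne_top K)
    n hD (Subtype.val : H → TreeAut d)
  set w : DirectedWreath Λ S H → ENNReal := fun y =>
    TreeAut.weight z n (Subtype.val : H → TreeAut d) (boundaryData y) with hw
  have hwsum : ∑' y, w y ≤ B :=
    (ENNReal.tsum_comp_le_tsum_of_injective boundaryData_injective _).trans htsum
  have hwfin : ∀ y, w y ≠ ⊤ := fun y =>
    ne_top_of_le_ne_top (ENNReal.natCast_ne_top B) ((ENNReal.le_tsum y).trans hwsum)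
  have hlow : ∀ ω : Fin n → Λ × H × S,
      (K : ℝ)⁻¹ ^ (2 * (visited pairStep (basePoint S H)
        ((List.ofFn ω).map Prod.snd)).card) ≤
        (w ((List.ofFn ω).map (switchStep pairStep (basePoint S H))).prod).toReal := by
    intro ω
    have h := (reach_word hS (List.ofFn ω)).pow_le_weight hz1 n (directedFamily_coe hH) (by
      refine Finset.card_image_le.trans ((card_visited_le _ _ _).trans ?_)
      simp)
    rw [Finset.card_image_of_injective _ Subtype.val_injective] at h
    rw [← hzr, ← ENNReal.toReal_pow]
    exact ENNReal.toReal_mono (hwfin _)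
      ((pow_le_pow_right_of_le_one' hz1 (Nat.sub_le _ 1)).trans h)
  have hqnn : ∀ a, 0 ≤ (q a).toReal := fun a => ENNReal.toReal_nonneg
  have hent := shannonEntropy_le
    (walkLaw (q.map (switchStep pairStep (basePoint S H))) n)
    (P := fun ω : Fin n → Λ × H × S => ∏ i, (q (ω i)).toReal)
    (by
      have h := pathSum_eq_sum (fun a => (q a).toReal) n fun _ => (1 : ℝ)
      rw [pathSum_const _ (sum_toReal_eq_one q)] at h
      simpa using h.symm)
    (fun ω => ((List.ofFn ω).map (switchStep pairStep (basePoint S H))).prod)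
    (fun x => by
      rw [walkLaw_map_toReal, pathSum_eq_sum])
    (w := fun y => (w y).toReal) (B := B) (by exact_mod_cast hB1)
    (fun y => ENNReal.toReal_nonneg) (fun ω => lt_of_lt_of_le (by positivity) (hlow ω))
    (fun s => by
      rw [← ENNReal.toReal_sum fun y _ => hwfin y]
      exact ENNReal.toReal_le_of_le_ofReal (by positivity) (by
        rw [ENNReal.ofReal_natCast]
        exact (ENNReal.sum_le_tsum s).trans hwsum))
  have hmean : ∑ ω : Fin n → Λ × H × S, (∏ i, (q (ω i)).toReal) * -Real.log
      (w ((List.ofFn ω).map (switchStep pairStep (basePoint S H))).prod).toReal ≤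
      2 * Real.log K * meanVisited pairStep (basePoint S H) p n := by
    have hmap : ∀ F : H × S → ℝ, ∑ a : Λ × H × S, (q a).toReal * F a.2 = ∑ c, p c * F c := by
      intro F
      have hc : (Fintype.card Λ : ℝ) ≠ 0 := by exact_mod_cast Fintype.card_ne_zero
      simp only [hq, Fintype.sum_prod_type (α₁ := Λ), Finset.sum_const, Finset.card_univ,
        nsmul_eq_mul, Finset.mul_sum]
      refine Finset.sum_congr rfl fun c _ => ?_
      field_simp
    rw [meanVisited, ← pathSum_map (fun a => (q a).toReal) p Prod.snd hmap,
      ← pathSum_const_mul, pathSum_eq_sum]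
    refine Finset.sum_le_sum fun ω _ =>
      mul_le_mul_of_nonneg_left ?_ (Finset.prod_nonneg fun i _ => hqnn _)
    have h := Real.log_le_log (by positivity) (hlow ω)
    rw [Real.log_pow, Real.log_inv] at h
    push_cast at h
    linarith
  have h1 := one_le_meanVisited (pairStep (S := S) (H := H)) (basePoint S H) hp hp1 hn
  calc _ ≤ _ := hent
    _ ≤ Real.log B * meanVisited pairStep (basePoint S H) p n +
        2 * Real.log K * meanVisited pairStep (basePoint S H) p n :=
      add_le_add (le_mul_of_one_le_right hlogB h1) hmean
    _ ≤ _ := by nlinarith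

end DirectedSwitchWalk

/-! ## Recurrence of the orbital chain of a saturated directed group -/

namespace TreeAut

open scoped Classical

variable {d : DegreeSeq} {I : Type*}

/-- The saturation property for a finite family of tree automorphisms. -/
def IsSaturatedFamily (θ : I → TreeAut d) : Prop :=
  ∀ (k : ℕ) (i : Fin ((d.shiftN k).deg 0)), i ≠ (d.shiftN k).first 0 →
    ∀ (σ : Equiv.Perm (Fin ((d.shiftN k).deg 0)))
      (τ : Equiv.Perm (Fin ((d.shiftN k).shift.deg 0))),
      Nat.card {h : I // rootPerm (spineSect k (θ h)) = σ ∧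
          rootPerm (sect (spineSect k (θ h)) i) = τ} *
        Nat.card (Equiv.Perm (Fin ((d.shiftN k).shift.deg 0))) =
      Nat.card {h : I // rootPerm (spineSect k (θ h)) = σ}

theorem IsSaturatedFamily.firstSects {θ : I → TreeAut d} (hθ : IsSaturatedFamily θ) :
    IsSaturatedFamily (firstSects θ) := fun k => hθ (k + 1)

variable [Fintype I]

/-- Composing with the transposition of `v` and `w` shows that the sum does not depend on the letter
`v`; then average over all letters. -/
theorem card_mul_sum_perm {n : ℕ} (f : Fin n → ℝ) (v : Fin n) :
    (n : ℝ) * ∑ τ : Equiv.Perm (Fin n), f (τ v) =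
      Fintype.card (Equiv.Perm (Fin n)) * ∑ u, f u := by
  have h : ∀ w, ∑ τ : Equiv.Perm (Fin n), f (τ v) = ∑ τ : Equiv.Perm (Fin n), f (τ w) := by
    intro w
    rw [← Equiv.sum_comp (Equiv.mulRight (Equiv.swap v w))]
    refine Finset.sum_congr rfl fun τ _ => ?_
    rw [Equiv.coe_mulRight, Equiv.Perm.mul_apply, Equiv.swap_apply_left]
  have h1 : ∑ w, ∑ τ : Equiv.Perm (Fin n), f (τ w) =
      (n : ℝ) * ∑ τ : Equiv.Perm (Fin n), f (τ v) := by
    rw [Finset.sum_congr rfl fun w _ => (h w).symm, Finset.sum_const, Finset.card_univ,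
      Fintype.card_fin, nsmul_eq_mul]
  rw [← h1, Finset.sum_comm, Finset.sum_congr rfl fun τ _ => Equiv.sum_comp τ f,
    Finset.sum_const, Finset.card_univ, nsmul_eq_mul]

/-- In a saturated family, conditionally on the permutation of the first level, the letter of the
second level below a vertex other than the leftmost one becomes uniform. -/
theorem IsSaturatedFamily.sum_eq {θ : I → TreeAut d} (hθ : IsSaturatedFamily θ)
    {i : Fin (d.deg 0)} (hi : i ≠ d.first 0) (v : Fin (d.shift.deg 0))
    (f : Equiv.Perm (Fin (d.deg 0)) → Fin (d.shift.deg 0) → ℝ) :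
    ∑ h, f (rootPerm (θ h)) (rootPerm (sect (θ h) i) v) =
      ∑ h, (∑ u, f (rootPerm (θ h)) u) / d.shift.deg 0 := by
  have hn : (0 : ℝ) < d.shift.deg 0 := by
    exact_mod_cast (lt_of_lt_of_le Nat.zero_lt_two (d.shift.two_le 0))
  have hP : (0 : ℝ) < Fintype.card (Equiv.Perm (Fin (d.shift.deg 0))) := by
    exact_mod_cast Fintype.card_pos
  have hfib : ∀ F : I → ℝ, ∑ h, F h = ∑ σ, ∑ h with rootPerm (θ h) = σ, F h := fun F =>
    (Finset.sum_fiberwise Finset.univ (fun h => rootPerm (θ h)) F).symm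
  rw [hfib, hfib fun h => (∑ u, f (rootPerm (θ h)) u) / d.shift.deg 0]
  refine Finset.sum_congr rfl fun σ _ => ?_
  have hcard : ∀ τ, ((Finset.univ.filter fun h =>
      rootPerm (θ h) = σ ∧ rootPerm (sect (θ h) i) = τ).card : ℝ) *
        Fintype.card (Equiv.Perm (Fin (d.shift.deg 0))) =
      (Finset.univ.filter fun h => rootPerm (θ h) = σ).card := by
    intro τ
    have h : Nat.card {h : I // rootPerm (θ h) = σ ∧ rootPerm (sect (θ h) i) = τ} *
        Nat.card (Equiv.Perm (Fin (d.shift.deg 0))) =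
      Nat.card {h : I // rootPerm (θ h) = σ} := hθ 0 i hi σ τ
    simp only [Nat.card_eq_fintype_card, Fintype.card_subtype] at h
    exact_mod_cast h
  have h1 : ∑ h with rootPerm (θ h) = σ, f (rootPerm (θ h)) (rootPerm (sect (θ h) i) v) =
      ∑ τ : Equiv.Perm (Fin (d.shift.deg 0)), ((Finset.univ.filter fun h =>
        rootPerm (θ h) = σ ∧ rootPerm (sect (θ h) i) = τ).card : ℝ) * f σ (τ v) := by
    rw [← Finset.sum_fiberwise _ fun h => rootPerm (sect (θ h) i)]
    refine Finset.sum_congr rfl fun τ _ => ?_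
    rw [Finset.filter_filter, Finset.sum_congr rfl (g := fun _ => f σ (τ v)) fun h hh => by
      obtain ⟨-, h1, h2⟩ := Finset.mem_filter.1 hh
      rw [h1, h2]]
    rw [Finset.sum_const, nsmul_eq_mul]
  have h2 : ∑ h with rootPerm (θ h) = σ, (∑ u, f (rootPerm (θ h)) u) / d.shift.deg 0 =
      ((Finset.univ.filter fun h => rootPerm (θ h) = σ).card : ℝ) *
        ((∑ u, f σ u) / d.shift.deg 0) := by
    rw [Finset.sum_congr rfl (g := fun _ => (∑ u, f σ u) / d.shift.deg 0) fun h hh => by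
      rw [(Finset.mem_filter.1 hh).2], Finset.sum_const, nsmul_eq_mul]
  rw [h1, h2]
  have h3 := card_mul_sum_perm (f σ) v
  have h4 : ∀ τ, ((Finset.univ.filter fun h =>
      rootPerm (θ h) = σ ∧ rootPerm (sect (θ h) i) = τ).card : ℝ) =
      (Finset.univ.filter fun h => rootPerm (θ h) = σ).card /
        Fintype.card (Equiv.Perm (Fin (d.shift.deg 0))) := fun τ => by
    rw [eq_div_iff hP.ne', hcard]
  simp only [h4]
  rw [← Finset.mul_sum, div_mul_eq_mul_div, ← mul_div_assoc, div_eq_div_iff hP.ne' hn.ne',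
    mul_assoc, mul_comm _ (d.shift.deg 0 : ℝ), h3]
  ring

/-- The probability that the orbital chain from `y` first enters the set of rays through the
leftmost vertex of level `j` at another point than the leftmost ray. -/
noncomputable def missProb : ℕ → {d : DegreeSeq} → Boundary d → ℝ
  | 0, d, y => if y = leftmostRay d then 0 else 1
  | j + 1, d, y =>
    if y 0 = d.first 0 then missProb j (tail y)
    else (∑ u, missProb j (cons u (tail (tail y)))) / d.shift.deg 0

theorem missProb_succ_cons (j : ℕ) (a : Fin (d.deg 0)) (w : Boundary d.shift) :
    missProb (j + 1) (cons a w) =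
      if a = d.first 0 then missProb j w
      else (∑ u, missProb j (cons u (tail w))) / d.shift.deg 0 := rfl

theorem missProb_nonneg (j : ℕ) (y : Boundary d) : 0 ≤ missProb j y := by
  induction j generalizing d with
  | zero => rw [missProb]; split_ifs <;> norm_num
  | succ j ih =>
    rw [missProb]
    split_ifs
    · exact ih _
    · exact div_nonneg (Finset.sum_nonneg fun u _ => ih _) (Nat.cast_nonneg _)

theorem missProb_leftmostRay (j : ℕ) (d : DegreeSeq) : missProb j (leftmostRay d) = 0 := by
  induction j generalizing d with
  | zero => rw [missProb, if_pos rfl]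
  | succ j ih => exact (if_pos rfl).trans (ih _)

theorem missProb_of_forall_first (j : ℕ) (y : Boundary d) (h : ∀ k < j, y k = d.first k)
    (hy : y ≠ leftmostRay d) : missProb j y = 1 := by
  induction j generalizing d with
  | zero => rw [missProb, if_neg hy]
  | succ j ih =>
    rw [missProb, if_pos (h 0 (Nat.succ_pos j))]
    refine ih _ (fun k hk => h (k + 1) (by omega)) fun h' => hy ?_
    rw [← cons_tail y, h', h 0 (Nat.succ_pos j), cons_first]

/-- Unless `a` is the first letter, where the value is `0`, the next letter is drawn uniformly. It
is the leftmost one, which leads to `1^∞`, with probability at least `1 / D`; otherwise the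
situation recurs one level down. -/
theorem missProb_cons_leftmostRay_le {D : ℕ} (j : ℕ) {d : DegreeSeq} (hD : ∀ k, d.deg k ≤ D)
    (a : Fin (d.deg 0)) :
    missProb j (cons a (leftmostRay d.shift)) ≤ (1 - (D : ℝ)⁻¹) ^ j := by
  have hD2 : (2 : ℝ) ≤ D := by exact_mod_cast (d.two_le 0).trans (hD 0)
  have hβ : 0 ≤ 1 - (D : ℝ)⁻¹ := by
    have := inv_le_one_of_one_le₀ (show (1 : ℝ) ≤ D by linarith)
    linarith
  induction j generalizing d with
  | zero =>
    rw [missProb, pow_zero]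
    split_ifs <;> norm_num
  | succ j ih =>
    have hpow : 0 ≤ (1 - (D : ℝ)⁻¹) ^ j := pow_nonneg hβ j
    rw [missProb]
    split_ifs with h
    · rw [tail_cons, missProb_leftmostRay]
      exact pow_nonneg hβ _
    · have hn : (0 : ℝ) < d.shift.deg 0 := by
        exact_mod_cast (lt_of_lt_of_le Nat.zero_lt_two (d.shift.two_le 0))
      have hle : (d.shift.deg 0 : ℝ) ≤ D := by exact_mod_cast hD 1
      rw [div_le_iff₀ hn, ← Finset.add_sum_erase _ _ (Finset.mem_univ (d.shift.first 0))]
      have h0 : missProb j (cons (d.shift.first 0) (tail (tail (cons a (leftmostRay d.shift))))) =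
          0 := (congrArg (missProb j) cons_first).trans (missProb_leftmostRay j _)
      rw [h0, zero_add]
      refine (Finset.sum_le_card_nsmul _ _ ((1 - (D : ℝ)⁻¹) ^ j)
        fun u _ => ih (fun k => hD (k + 1)) u).trans ?_
      rw [Finset.card_erase_of_mem (Finset.mem_univ _), Finset.card_univ, Fintype.card_fin,
        nsmul_eq_mul, Nat.cast_sub ((Nat.le_succ 1).trans (d.shift.two_le 0)), Nat.cast_one,
        pow_succ]
      have hinv : (d.shift.deg 0 : ℝ) * (D : ℝ)⁻¹ ≤ 1 := by
        rw [← div_eq_mul_inv]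
        exact div_le_one_of_le₀ hle (by linarith)
      nlinarith

/-- With `c` the root permutation of `s ∈ S`, this is harmonicity of `missProb` outside the cylinder
for the chain of `s h`. Arbitrary maps `c` are allowed because the induction also needs constant
ones. -/
theorem sum_missProb {θ : I → TreeAut d} (hdir : ∀ i, IsDirected (θ i))
    (hsat : IsSaturatedFamily θ) (j : ℕ) (y : Boundary d) (hy : ∃ k < j, y k ≠ d.first k)
    (c : Fin (d.deg 0) → Fin (d.deg 0)) :
    ∑ h, missProb j (cons (c ((θ h).1 y 0)) (tail ((θ h).1 y))) =
      Fintype.card I * missProb j y := by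
  induction j generalizing d with
  | zero =>
    obtain ⟨k, hk, -⟩ := hy
    exact absurd hk (Nat.not_lt_zero k)
  | succ j ih =>
    by_cases h0 : y 0 = d.first 0
    · have hy' : ∃ k < j, tail y k ≠ d.shift.first k := by
        obtain ⟨k, hk, hne⟩ := hy
        cases k with
        | zero => exact absurd h0 hne
        | succ k => exact ⟨k, by omega, hne⟩
      have happ : ∀ h, (θ h).1 y = cons (d.first 0) ((firstSects θ h).1 (tail y)) := fun h => by
        conv_lhs => rw [← cons_tail y, h0, apply_cons, (hdir h).rootPerm_first]
        rfl
      have ih' := ih (θ := firstSects θ) (fun h => (hdir h).sect_first) hsat.firstSects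
        (tail y) hy'
      simp only [happ, missProb_succ_cons, tail_cons]
      rw [missProb, if_pos h0]
      change ∑ h, (if c (d.first 0) = d.first 0 then missProb j ((firstSects θ h).1 (tail y))
        else (∑ u, missProb j (cons u (tail ((firstSects θ h).1 (tail y))))) /
          d.shift.deg 0) = _
      -- If `c` keeps the leftmost letter, the chain stays in the leftmost subtree and induction
      -- applies with `id`. If not, the next letter `u` is averaged, and induction applies with each
      -- constant map `u`.
      split_ifs with hc
      · have := ih' id
        simpa only [id, cons_tail] using this
      · have hn : (d.shift.deg 0 : ℝ) ≠ 0 := by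
          exact_mod_cast (lt_of_lt_of_le Nat.zero_lt_two (d.shift.two_le 0)).ne'
        rw [← Finset.sum_div, Finset.sum_comm, Finset.sum_congr rfl fun u _ => ih' fun _ => u,
          Finset.sum_const, Finset.card_univ, Fintype.card_fin, nsmul_eq_mul,
          mul_div_cancel_left₀ _ hn]
    · have happ : ∀ h, (θ h).1 y = cons (rootPerm (θ h) (y 0))
          (cons (rootPerm (sect (θ h) (y 0)) (y 1)) (tail (tail y))) := fun h => by
        conv_lhs => rw [← cons_tail y, apply_cons, ← cons_tail (tail y),
          ((hdir h).isRooted_sect h0).apply_cons]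
        rfl
      simp only [happ]
      rw [missProb, if_neg h0]
      have h := hsat.sum_eq h0 (y 1) fun σ v =>
        missProb (j + 1) (cons (c (σ (y 0))) (cons v (tail (tail y))))
      refine h.trans ?_
      -- Once the second letter is uniform, the first one no longer matters: below the leftmost
      -- vertex the average is over the actual letter, elsewhere it is built into `missProb`.
      have hconst : ∀ a : Fin (d.deg 0), (∑ u, missProb (j + 1) (cons a (cons u (tail (tail y))))) /
          (d.shift.deg 0 : ℝ) = (∑ u, missProb j (cons u (tail (tail y)))) / d.shift.deg 0 := by
        intro a
        have hn : (d.shift.deg 0 : ℝ) ≠ 0 := by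
          exact_mod_cast (lt_of_lt_of_le Nat.zero_lt_two (d.shift.two_le 0)).ne'
        simp only [missProb_succ_cons, tail_cons]
        by_cases ha : a = d.first 0
        · rw [Finset.sum_congr rfl fun u _ => if_pos ha]
        · rw [Finset.sum_congr rfl fun u _ => if_neg ha, Finset.sum_const, Finset.card_univ,
            Fintype.card_fin, nsmul_eq_mul, mul_div_cancel_left₀ _ hn]
      rw [Finset.sum_congr rfl fun h _ => hconst (c (rootPerm (θ h) (y 0))), Finset.sum_const,
        Finset.card_univ, nsmul_eq_mul]

end TreeAut

/-! ### Return to the leftmost vertex of a given level -/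

section Cylinder

open scoped Classical

variable {d : DegreeSeq} {Γ : Type*} [Fintype Γ] (γ : Γ → TreeAut d) (p : Γ → ℝ) (j : ℕ)

/-- The ray goes through the leftmost vertex of level `j`. -/
def InCylinder (j : ℕ) (x : Boundary d) : Prop := ∀ k < j, x k = d.first k

/-- The probability that the orbital chain from `x` does not meet the rays through the leftmost
vertex of level `j` in the steps `1, …, n`. -/
noncomputable def cylinderEscape : ℕ → Boundary d → ℝ
  | 0, _ => 1
  | n + 1, x => ∑ c, p c *
      if InCylinder j ((γ c).1 x) then 0 else cylinderEscape n ((γ c).1 x)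

theorem InCylinder.congr {x y : Boundary d} (h : ∀ k < j, x k = y k) :
    InCylinder j x ↔ InCylinder j y :=
  forall₂_congr fun k hk => by rw [h k hk]

theorem cylinderEscape_congr (n : ℕ) {x y : Boundary d} (h : ∀ k < j, x k = y k) :
    cylinderEscape γ p j n x = cylinderEscape γ p j n y := by
  induction n generalizing x y with
  | zero => rfl
  | succ n ih =>
    refine Finset.sum_congr rfl fun c _ => ?_
    have h' := ((γ c).2 x y j).2 h
    exact congrArg _ (if_congr (InCylinder.congr j h') rfl (ih h'))

theorem cylinderEscape_nonneg {p : Γ → ℝ} (hp : ∀ c, 0 ≤ p c) (n : ℕ) (x : Boundary d) :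
    0 ≤ cylinderEscape γ p j n x := by
  induction n generalizing x with
  | zero => exact zero_le_one
  | succ n ih =>
    exact Finset.sum_nonneg fun c _ => mul_nonneg (hp c) (by split_ifs; exacts [le_rfl, ih _])

/-- The ray which follows a path of length `j` and then leftmost letters. -/
def extendPath (z : ∀ k : Fin j, Fin (d.deg k)) : Boundary d := fun k =>
  if h : k < j then z ⟨k, h⟩ else d.first k

/-- The initial path of length `j` of a ray. -/
def initialPath (x : Boundary d) : ∀ k : Fin j, Fin (d.deg k) := fun k => x k

theorem initialPath_extendPath (z : ∀ k : Fin j, Fin (d.deg k)) :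
    initialPath j (extendPath j z) = z := funext fun k => dif_pos k.2

theorem initialPath_eq {x y : Boundary d} :
    initialPath j x = initialPath j y ↔ ∀ k < j, x k = y k :=
  ⟨fun h k hk => congrFun h ⟨k, hk⟩, fun h => funext fun k => h k k.2⟩

theorem extendPath_initialPath (x : Boundary d) :
    ∀ k < j, extendPath j (initialPath j x) k = x k := fun _ hk => dif_pos hk

theorem sum_apply_extendPath (g : TreeAut d) (f : Boundary d → ℝ)
    (hf : ∀ x y : Boundary d, (∀ k < j, x k = y k) → f x = f y) :
    ∑ z, f (g.1 (extendPath j z)) = ∑ z, f (extendPath j z) := by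
  have hbij : Function.Bijective fun z => initialPath j (g.1 (extendPath j z)) := by
    refine Finite.injective_iff_bijective.1 fun z z' h => ?_
    have h' := (g.2 _ _ j).1 ((initialPath_eq j).1 h)
    rw [← initialPath_extendPath j z, ← initialPath_extendPath j z']
    exact (initialPath_eq j).2 h'
  rw [← hbij.sum_comp fun z => f (extendPath j z)]
  exact Finset.sum_congr rfl fun z _ => hf _ _ fun k hk => (extendPath_initialPath j _ k hk).symm

/-- Tree automorphisms permute level `j`, so one step preserves the sum over its vertices, except
that the term of the leftmost vertex is killed. -/
theorem sum_cylinderEscape_succ {p : Γ → ℝ} (hp1 : ∑ c, p c = 1) (n : ℕ) :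
    ∑ z, cylinderEscape γ p j (n + 1) (extendPath j z) +
      cylinderEscape γ p j n (leftmostRay d) = ∑ z, cylinderEscape γ p j n (extendPath j z) := by
  set f : Boundary d → ℝ := fun x => if InCylinder j x then 0 else cylinderEscape γ p j n x
  have hf : ∀ x y : Boundary d, (∀ k < j, x k = y k) → f x = f y := fun x y h =>
    if_congr (InCylinder.congr j h) rfl (cylinderEscape_congr γ p j n h)
  have h1 : ∑ z, cylinderEscape γ p j (n + 1) (extendPath j z) = ∑ z, f (extendPath j z) := by
    simp only [cylinderEscape]
    rw [Finset.sum_comm]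
    have : ∀ c, ∑ z, p c * f ((γ c).1 (extendPath j z)) = p c * ∑ z, f (extendPath j z) :=
      fun c => by rw [← Finset.mul_sum, sum_apply_extendPath j (γ c) f hf]
    rw [Finset.sum_congr rfl fun c _ => this c, ← Finset.sum_mul, hp1, one_mul]
  set z₀ := initialPath j (leftmostRay d)
  have hz₀ : cylinderEscape γ p j n (leftmostRay d) =
      cylinderEscape γ p j n (extendPath j z₀) :=
    cylinderEscape_congr γ p j n fun k hk => (extendPath_initialPath j _ k hk).symm
  rw [h1, hz₀, ← Finset.add_sum_erase _ _ (Finset.mem_univ z₀),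
    ← Finset.add_sum_erase _ (fun z => cylinderEscape γ p j n (extendPath j z))
      (Finset.mem_univ z₀)]
  have h2 : f (extendPath j z₀) = 0 := if_pos fun k hk => extendPath_initialPath j _ k hk
  have h3 : ∀ z ∈ Finset.univ.erase z₀,
      f (extendPath j z) = cylinderEscape γ p j n (extendPath j z) := fun z hz =>
    if_neg fun h => (Finset.mem_erase.1 hz).1 (by
      rw [← initialPath_extendPath j z]
      exact (initialPath_eq j).2 h)
  rw [h2, zero_add, Finset.sum_congr rfl h3, add_comm]

/-- The nonnegative sums over level `j` decrease at each step by the escape probability from the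
leftmost vertex, which cannot stay above `δ`. -/
theorem exists_cylinderEscape_le {p : Γ → ℝ} (hp : ∀ c, 0 ≤ p c) (hp1 : ∑ c, p c = 1) {δ : ℝ}
    (hδ : 0 < δ) : ∃ n, cylinderEscape γ p j n (leftmostRay d) ≤ δ := by
  set s : ℕ → ℝ := fun n => ∑ z, cylinderEscape γ p j n (extendPath j z)
  have hs : ∀ n, 0 ≤ s n := fun n => Finset.sum_nonneg fun z _ => cylinderEscape_nonneg γ j hp n _
  by_contra! h
  have hlin : ∀ n : ℕ, s n ≤ s 0 - n * δ := by
    intro n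
    induction n with
    | zero => simp
    | succ n ih =>
      have h1 := sum_cylinderEscape_succ γ j hp1 n
      have h2 := h n
      push_cast
      simp only [s] at ih ⊢
      linarith
  obtain ⟨n, hn⟩ := exists_nat_gt (s 0 / δ)
  have h1 := hlin n
  have h2 := hs n
  rw [div_lt_iff₀ hδ] at hn
  linarith

end Cylinder

/-! ### Recurrence -/

section Recurrence

open scoped Classical

variable {d : DegreeSeq}

/-- To avoid `1^∞` the chain must avoid the cylinder or enter it first at another point. By
harmonicity `missProb` bounds the second event; its mean is taken after one step because the start
may lie in the cylinder. -/
theorem escapeProb_le_add {Γ : Type*} [Fintype Γ] (γ : Γ → TreeAut d) {p : Γ → ℝ}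
    (hp : ∀ c, 0 ≤ p c) (hp1 : ∑ c, p c = 1) (j : ℕ)
    (hF : ∀ y, ¬InCylinder j y →
      ∑ c, p c * TreeAut.missProb j ((γ c).1 y) = TreeAut.missProb j y)
    (n : ℕ) (y : Boundary d) :
    escapeProb γ (leftmostRay d) p n y ≤
      cylinderEscape γ p j n y + ∑ c, p c * TreeAut.missProb j ((γ c).1 y) := by
  have hnn : ∀ y : Boundary d, 0 ≤ ∑ c, p c * TreeAut.missProb j ((γ c).1 y) := fun y =>
    Finset.sum_nonneg fun c _ => mul_nonneg (hp c) (TreeAut.missProb_nonneg j _)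
  have hle : ∀ (m : ℕ) (x : Boundary d), escapeProb γ (leftmostRay d) p m x ≤ 1 := by
    intro m
    induction m with
    | zero => exact fun x => le_rfl
    | succ m ih =>
      intro x
      refine (Finset.sum_le_sum fun c _ => mul_le_of_le_one_right (hp c) ?_).trans hp1.le
      split_ifs
      exacts [zero_le_one, ih _]
  induction n generalizing y with
  | zero =>
    simp only [escapeProb, cylinderEscape]
    linarith [hnn y]
  | succ n ih =>
    rw [escapeProb, cylinderEscape, ← Finset.sum_add_distrib]
    refine Finset.sum_le_sum fun c _ => ?_
    rw [← mul_add]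
    refine mul_le_mul_of_nonneg_left ?_ (hp c)
    change (if (γ c).1 y = leftmostRay d then 0
      else escapeProb γ (leftmostRay d) p n ((γ c).1 y)) ≤ _
    by_cases ho : (γ c).1 y = leftmostRay d
    · have : InCylinder j (leftmostRay d) := fun _ _ => rfl
      rw [if_pos ho, ho, if_pos this, TreeAut.missProb_leftmostRay, add_zero]
    · rw [if_neg ho]
      by_cases hC : InCylinder j ((γ c).1 y)
      · rw [if_pos hC, zero_add, TreeAut.missProb_of_forall_first j _ hC ho]
        exact hle _ _
      · rw [if_neg hC, ← hF _ hC]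
        exact ih _

variable {S : Set (TreeAut d)} {H : Subgroup (TreeAut d)}

theorem escapeProb_pairStep [Fintype S] [Fintype H] (p : H × S → ℝ) (n : ℕ)
    (x : leftmostOrbit S H) :
    escapeProb pairStep (basePoint S H) p n x =
      escapeProb (fun c : H × S => c.1.1 * c.2.1) (leftmostRay d) p n x.1 := by
  induction n generalizing x with
  | zero => rfl
  | succ n ih =>
    refine Finset.sum_congr rfl fun c _ => congrArg _ ?_
    split_ifs with h1 h2 h2
    · rfl
    · exact absurd (congrArg Subtype.val h1) h2
    · exact absurd (Subtype.ext h2) h1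
    · exact ih _

/-- The orbital chains of `h s` and of `s h` have the same return times to the leftmost ray. -/
theorem sum_escapeProb_comm [Fintype S] [Fintype H] (hH : ∀ h ∈ H, TreeAut.IsDirected h) (w : ℝ)
    (n : ℕ) (y : Boundary d) :
    ∑ h : H, escapeProb (fun c : H × S => c.1.1 * c.2.1) (leftmostRay d) (fun _ => w) n (h.1.1 y) =
      Fintype.card H *
        escapeProb (fun c : H × S => c.2.1 * c.1.1) (leftmostRay d) (fun _ => w) n y := by
  -- Every `h` fixes `1^∞`, so a visit may be checked before or after applying `h`.
  have hfix : ∀ (h : H) (x : Boundary d), h.1.1 x = leftmostRay d ↔ x = leftmostRay d :=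
    fun h x => by
      nth_rw 1 [← (hH h.1 h.2).apply_leftmostRay]
      exact h.1.1.injective.eq_iff
  induction n generalizing y with
  | zero => simp [escapeProb]
  | succ n ih =>
    have hstep : ∀ x : Boundary d,
        escapeProb (fun c : H × S => c.1.1 * c.2.1) (leftmostRay d) (fun _ => w) (n + 1) x =
          ∑ s : S, w * if s.1.1 x = leftmostRay d then 0 else Fintype.card H *
            escapeProb (fun c : H × S => c.2.1 * c.1.1) (leftmostRay d) (fun _ => w) n
              (s.1.1 x) := by
      intro x
      rw [escapeProb, Fintype.sum_prod_type_right]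
      refine Finset.sum_congr rfl fun s _ => ?_
      rw [← Finset.mul_sum]
      congr 1
      have happ : ∀ h : H, (h.1 * s.1) • x = h.1.1 (s.1.1 x) := fun h => rfl
      simp only [happ, hfix]
      split_ifs
      · exact Finset.sum_const_zero
      · exact ih _
    simp only [hstep]
    rw [escapeProb, Fintype.sum_prod_type, Finset.mul_sum]
    refine Finset.sum_congr rfl fun h _ => ?_
    rw [Finset.mul_sum]
    refine Finset.sum_congr rfl fun s _ => ?_
    change w * (if s.1.1 (h.1.1 y) = leftmostRay d then 0 else _) =
      _ * (w * if s.1.1 (h.1.1 y) = leftmostRay d then 0 else _)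
    split_ifs
    · simp
    · rw [mul_left_comm]
      rfl

/-- The orbital chain of a saturated directed group on a tree of bounded degree is recurrent. -/
theorem exists_escapeProb_le [Fintype S] [Nonempty S] [Fintype H]
    (hSH : IsSaturatedDirectedPair S H) {D : ℕ} (hD : ∀ k, d.deg k ≤ D) {δ : ℝ} (hδ : 0 < δ) :
    ∃ n, escapeProb pairStep (basePoint S H)
      (fun _ : H × S => (Fintype.card H : ℝ)⁻¹ * (Fintype.card S : ℝ)⁻¹) n (basePoint S H) ≤
        δ := by
  have hcH : (0 : ℝ) < Fintype.card H := by exact_mod_cast Fintype.card_pos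
  have hcS : (0 : ℝ) < Fintype.card S := by exact_mod_cast Fintype.card_pos
  set w : ℝ := (Fintype.card H : ℝ)⁻¹ * (Fintype.card S : ℝ)⁻¹ with hw
  have hw0 : 0 ≤ w := by positivity
  have hw1 : ∑ _c : H × S, w = 1 := by
    rw [Finset.sum_const, Finset.card_univ, Fintype.card_prod, nsmul_eq_mul, hw]
    push_cast
    field_simp
  have hD2 : (2 : ℝ) ≤ D := by exact_mod_cast (d.two_le 0).trans (hD 0)
  have hβ0 : 0 ≤ 1 - (D : ℝ)⁻¹ := by
    have := inv_le_one_of_one_le₀ (show (1 : ℝ) ≤ D by linarith)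
    linarith
  have hβ1 : 1 - (D : ℝ)⁻¹ < 1 := by
    have : 0 < (D : ℝ)⁻¹ := by positivity
    linarith
  -- The level `j` is fixed first, to make a wrong entrance unlikely; then the time `n`, to make a
  -- return to that cylinder likely.
  obtain ⟨j, hj⟩ := exists_pow_lt_of_lt_one (half_pos hδ) hβ1
  obtain ⟨n, hn⟩ := exists_cylinderEscape_le (fun c : H × S => c.2.1 * c.1.1) j
    (p := fun _ => w) (fun _ => hw0) hw1 (half_pos hδ)
  have hsat : TreeAut.IsSaturatedFamily (Subtype.val : H → TreeAut d) := hSH.saturated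
  have hroot : ∀ (s : S) (x : Boundary d),
      s.1.1 x = TreeAut.cons (TreeAut.rootPerm s.1 (x 0)) (TreeAut.tail x) := fun s x => by
    conv_lhs => rw [← TreeAut.cons_tail x, (hSH.rooted s.1 s.2).apply_cons]
  refine ⟨n, ?_⟩
  have hcomm := sum_escapeProb_comm (S := S) hSH.directed w n (leftmostRay d)
  rw [Finset.sum_congr rfl fun h _ => by rw [(hSH.directed h.1 h.2).apply_leftmostRay],
    Finset.sum_const, Finset.card_univ, nsmul_eq_mul] at hcomm
  rw [escapeProb_pairStep]
  refine (mul_left_cancel₀ hcH.ne' hcomm).le.trans ?_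
  refine (escapeProb_le_add _ (fun _ => hw0) hw1 j (fun y hy => ?_) n _).trans ?_
  · have hy' : ∃ k < j, y k ≠ d.first k := by
      simpa only [InCylinder, not_forall, exists_prop] using hy
    rw [Fintype.sum_prod_type_right]
    have hs : ∀ s : S, ∑ h : H, w * TreeAut.missProb j ((s.1 * h.1).1 y) =
        w * (Fintype.card H * TreeAut.missProb j y) := fun s => by
      rw [← Finset.mul_sum, ← TreeAut.sum_missProb (fun h : H => hSH.directed h.1 h.2) hsat j y hy'
        (TreeAut.rootPerm s.1)]
      congr 1
      exact Finset.sum_congr rfl fun h _ => by rw [TreeAut.mul_apply, hroot]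
    rw [Finset.sum_congr rfl fun s _ => hs s, Finset.sum_const, Finset.card_univ, nsmul_eq_mul, hw]
    field_simp
  · have hmiss : ∑ c : H × S, w * TreeAut.missProb j ((c.2.1 * c.1.1).1 (leftmostRay d)) ≤
        (1 - (D : ℝ)⁻¹) ^ j := by
      have hsum : ∑ _c : H × S, w * (1 - (D : ℝ)⁻¹) ^ j = (1 - (D : ℝ)⁻¹) ^ j := by
        rw [← Finset.sum_mul, hw1, one_mul]
      refine le_trans (Finset.sum_le_sum fun c _ => mul_le_mul_of_nonneg_left ?_ hw0) hsum.le
      rw [TreeAut.mul_apply, (hSH.directed _ c.1.2).apply_leftmostRay, hroot]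
      exact TreeAut.missProb_cons_leftmostRay_le j hD _
    linarith

end Recurrence

/-! ## Partial entropy noise sensitivity of saturated directed groups -/

section Main

open scoped Classical

theorem uniformLaw_apply {α : Type*} [Fintype α] [Nonempty α] (a : α) :
    uniformLaw α a = (Fintype.card α : ENNReal)⁻¹ := by
  refine (@PMF.uniformOfFintype_apply _ (Fintype.ofFinite α) _ a).trans ?_
  congr!

variable {d : DegreeSeq} {S : Set (TreeAut d)} {H : Subgroup (TreeAut d)}
  {Λ : Type*} [Group Λ]

variable (Λ S H) in
/-- The law of independent uniform elements of `Λ`, `H` and `S`. -/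
noncomputable def letterLaw [Finite Λ] [Finite S] [Nonempty S] [Finite H] : PMF (Λ × H × S) :=
  (uniformLaw Λ).bind fun l => (uniformLaw H).bind fun h => (uniformLaw S).map fun s => (l, h, s)

theorem switchWalk_eq_map [Finite Λ] [Finite S] [Nonempty S] [Finite H] :
    switchWalk Λ S H = (letterLaw S H Λ).map (switchStep pairStep (basePoint S H)) := by
  simp only [switchWalk, letterLaw, convolution, PMF.bind_map, PMF.map_bind, PMF.map_comp,
    PMF.bind_bind, Function.comp_def, switchStep, pairStep, map_mul, mul_assoc]
  rfl

theorem letterLaw_toReal [Fintype Λ] [Fintype S] [Nonempty S] [Fintype H] (a : Λ × H × S) :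
    (letterLaw S H Λ a).toReal =
      (Fintype.card Λ : ℝ)⁻¹ * ((Fintype.card H : ℝ)⁻¹ * (Fintype.card S : ℝ)⁻¹) := by
  obtain ⟨l, h, s⟩ := a
  have h1 : letterLaw S H Λ (l, h, s) =
      (Fintype.card Λ : ENNReal)⁻¹ * ((Fintype.card H : ENNReal)⁻¹ *
        (Fintype.card S : ENNReal)⁻¹) := by
    rw [letterLaw, PMF.bind_apply, tsum_eq_single l, PMF.bind_apply, tsum_eq_single h,
      PMF.map_apply, tsum_eq_single s, if_pos rfl, uniformLaw_apply, uniformLaw_apply,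
      uniformLaw_apply]
    · intro s' hs
      rw [if_neg fun h' => hs (by simpa using h'.symm)]
    · intro h' hh
      rw [PMF.map_apply, ENNReal.tsum_eq_zero.2, mul_zero]
      intro s'
      rw [if_neg fun h'' => hh (by simpa using (Prod.ext_iff.1 (Prod.ext_iff.1 h'').2).1.symm)]
    · intro l' hl
      rw [PMF.bind_apply, ENNReal.tsum_eq_zero.2, mul_zero]
      intro h'
      rw [PMF.map_apply, ENNReal.tsum_eq_zero.2, mul_zero]
      intro s'
      rw [if_neg fun h'' => hl (by simpa using (Prod.ext_iff.1 h'').1.symm)]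
  rw [h1]
  simp only [ENNReal.toReal_mul, ENNReal.toReal_inv, ENNReal.toReal_natCast]

theorem partiallyEntropyNoiseSensitive_switchWalk [Finite Λ] [Nontrivial Λ] [Finite S] [Nonempty S]
    [Finite H] (hSH : IsSaturatedDirectedPair S H) {D : ℕ} (hD : ∀ k, d.deg k ≤ D) :
    PartiallyEntropyNoiseSensitive (switchWalk Λ S H) := by
  have := Fintype.ofFinite Λ
  have := Fintype.ofFinite S
  have := Fintype.ofFinite H
  have hcH : (0 : ℝ) < Fintype.card H := by exact_mod_cast Fintype.card_pos
  have hcS : (0 : ℝ) < Fintype.card S := by exact_mod_cast Fintype.card_pos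
  set p : H × S → ℝ := fun _ => (Fintype.card H : ℝ)⁻¹ * (Fintype.card S : ℝ)⁻¹ with hp_def
  have hp : ∀ c, 0 ≤ p c := fun c => by positivity
  have hp1 : ∑ c, p c = 1 := by
    rw [hp_def, Finset.sum_const, Finset.card_univ, Fintype.card_prod, nsmul_eq_mul]
    push_cast
    field_simp
  have hlog : 0 < Real.log (Fintype.card Λ) :=
    Real.log_pos (by exact_mod_cast Fintype.one_lt_card)
  obtain ⟨C, hC, hup⟩ := exists_shannonEntropy_le hSH.rooted hSH.directed hD hp hp1
    (letterLaw S H Λ) letterLaw_toReal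
  rw [switchWalk_eq_map]
  -- The factor `2` comes from the half of the points that are resampled, and `C` from the upper
  -- bound on the entropy.
  refine ⟨Real.log (Fintype.card Λ) / (2 * C), by positivity, fun ρ h0 h1 => ?_⟩
  filter_upwards [half_meanVisited_le pairStep (basePoint S H) hp hp1
    (fun δ hδ => exists_escapeProb_le hSH hD hδ) (ρ := (ρ : ℝ)) h0 h1.le,
    Filter.eventually_gt_atTop 0] with n hn hn0
  refine le_trans ?_ (resampled_le_conditionalEntropy pairStep (basePoint S H) hp hp1
    (letterLaw S H Λ) letterLaw_toReal ρ n)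
  refine le_trans ?_ (mul_le_mul_of_nonneg_left hn hlog.le)
  calc _ ≤ Real.log (Fintype.card Λ) / (2 * C) *
        (C * meanVisited pairStep (basePoint S H) p n) :=
      mul_le_mul_of_nonneg_left (hup n hn0) (by positivity)
    _ = _ := by field_simp

end Main

/-! ## The first Grigorchuk group is a saturated directed group -/

namespace Grigorchuk

open TreeAut

theorem isRooted_a : IsRooted a := by
  refine fun i => Subtype.ext (Equiv.ext fun y => funext fun k => ?_)
  change (if k + 1 = 0 then (cons i y (k + 1)).rev else cons i y (k + 1)) = y k
  rw [if_neg (Nat.succ_ne_zero k)]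
  rfl

theorem rootPerm_directedFlip (e : ℕ → Bool) : rootPerm (directedFlip e) = 1 :=
  Equiv.ext fun _ => rfl

theorem afterFirst_cons_first (y : Boundary binary.shift) (k : ℕ) :
    AfterFirst (cons (binary.first 0) y) (k + 1) ↔ AfterFirst (y : Boundary binary) k := by
  cases k with
  | zero => exact iff_of_false (fun h => h.2 rfl) id
  | succ k =>
    simp only [AfterFirst]
    refine and_congr ⟨fun h j hj => h (j + 1) (by omega), fun h j hj => ?_⟩ Iff.rfl
    cases j with
    | zero => rfl
    | succ j => exact h j (by omega)

theorem sect_directedFlip_first (e : ℕ → Bool) :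
    sect (directedFlip e) (binary.first 0) = (directedFlip fun k => e (k + 1) : TreeAut binary) := by
  classical
  refine Subtype.ext (Equiv.ext fun y => funext fun k => ?_)
  change flip e (cons (binary.first 0) y) (k + 1) = flip (fun k => e (k + 1)) y k
  cases k with
  | zero =>
    simp only [flip]
    rw [if_neg fun h => (afterFirst_cons_first y 0).1 h.1]
    rfl
  | succ k =>
    simp only [flip]
    exact if_congr (and_congr_left fun _ => afterFirst_cons_first y (k + 1)) rfl rfl

theorem flip_cons_of_ne (e : ℕ → Bool) {i : Fin (binary.deg 0)} (hi : i ≠ binary.first 0)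
    (y : Boundary binary.shift) (k : ℕ) :
    flip e (cons i y) (k + 1) = if k = 0 ∧ e 0 = true then (y k).rev else y k := by
  classical
  have h : AfterFirst (cons i y) (k + 1) ↔ k = 0 := by
    cases k with
    | zero => exact iff_of_true ⟨fun j hj => absurd hj (Nat.not_lt_zero j), hi⟩ rfl
    | succ k => exact iff_of_false (fun h => hi (h.1 0 (Nat.succ_pos k))) (Nat.succ_ne_zero k)
  simp only [flip]
  refine if_congr ?_ rfl rfl
  rw [h]
  exact and_congr_right fun hk => by rw [hk]

theorem sect_directedFlip_of_ne (e : ℕ → Bool) {i : Fin (binary.deg 0)}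
    (hi : i ≠ binary.first 0) :
    IsRooted (sect (directedFlip e) i) ∧
      rootPerm (sect (directedFlip e) i) = if e 0 = true then Fin.revPerm else 1 := by
  have happ : ∀ (y : Boundary binary.shift) (k : ℕ), (sect (directedFlip e) i).1 y k =
      if k = 0 ∧ e 0 = true then (y k).rev else y k := fun y k => flip_cons_of_ne e hi y k
  constructor
  · intro j
    refine Subtype.ext (Equiv.ext fun y => funext fun k => ?_)
    exact (happ (cons j y) (k + 1)).trans (if_neg fun h => Nat.succ_ne_zero k h.1)
  · refine Equiv.ext fun j => ?_
    refine (happ (cons j (leftmostRay _)) 0).trans ?_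
    by_cases h : e 0 = true
    · rw [if_pos ⟨rfl, h⟩, if_pos h]
      rfl
    · rw [if_neg fun h' => h h'.2, if_neg h]
      rfl

theorem spineSect_directedFlip (k : ℕ) (e : ℕ → Bool) :
    rootPerm (spineSect k (directedFlip e)) = 1 ∧
      ∀ i, i ≠ (binary.shiftN k).first 0 → IsRooted (sect (spineSect k (directedFlip e)) i) ∧
        rootPerm (sect (spineSect k (directedFlip e)) i) =
          if e k = true then Fin.revPerm else 1 := by
  induction k generalizing e with
  | zero => exact ⟨rootPerm_directedFlip e, fun i hi => sect_directedFlip_of_ne e hi⟩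
  | succ k ih =>
    have h := ih fun k => e (k + 1)
    rw [← sect_directedFlip_first] at h
    exact h

theorem isDirected_directedFlip (e : ℕ → Bool) : IsDirected (directedFlip e) := fun k =>
  ⟨by rw [(spineSect_directedFlip k e).1]; rfl,
    fun i hi => ((spineSect_directedFlip k e).2 i hi).1⟩

theorem exists_directedFlip_eq {h : TreeAut binary} (hh : h ∈ directedPart) :
    ∃ e, directedFlip e = h := by
  obtain ⟨p, hp⟩ := directedPart_le hh
  exact ⟨_, hp⟩

/-- The pattern of `b` vanishes only on the class `2` modulo `3`, and that of `c` only on the class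
`1`, so one of them is active at level `k`. -/
theorem exists_mem_directedPart (k : ℕ) :
    ∃ e : ℕ → Bool, e k = true ∧ directedFlip e ∈ directedPart := by
  by_cases hk : k % 3 = 2
  · exact ⟨fun k => k % 3 != 1, by simp [hk], Subgroup.subset_closure (Or.inr (Or.inl rfl))⟩
  · exact ⟨fun k => k % 3 != 2, by simp [hk], Subgroup.subset_closure (Or.inl rfl)⟩

theorem shiftN_deg (k : ℕ) {d : DegreeSeq} (hd : ∀ m, d.deg m = 2) (m : ℕ) :
    (d.shiftN k).deg m = 2 := by
  induction k generalizing d with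
  | zero => exact hd m
  | succ k ih => exact ih fun m => hd (m + 1)

/-- As `B` has two elements, `g` embeds each fibre of `t` in the other one, so both have the same
size. It is applied to the left multiplication by an element of the directed part that is active at
level `k`. -/
theorem card_fiber_mul_of_ne {A B : Type*} [Fintype A] [Fintype B] [DecidableEq B]
    (hB : Fintype.card B = 2) (t : A → B) (g : A → A) (hg : Function.Injective g)
    (ht : ∀ x, t (g x) ≠ t x) (b : B) :
    (Finset.univ.filter fun x => t x = b).card * Fintype.card B = Fintype.card A := by
  have hle : ∀ b b' : B, (Finset.univ.filter fun x => t x = b).card ≤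
      (Finset.univ.filter fun x => t x = b').card := by
    intro b b'
    by_cases hbb : b = b'
    · rw [hbb]
    refine Finset.card_le_card_of_injOn g (fun x hx => ?_) hg.injOn
    have hx' : t x = b := (Finset.mem_filter.1 hx).2
    refine Finset.mem_coe.2 (Finset.mem_filter.2 ⟨Finset.mem_univ _, ?_⟩)
    by_contra hne
    have h3 : ({t (g x), b, b'} : Finset B).card = 3 :=
      Finset.card_eq_three.2 ⟨_, _, _, hx' ▸ ht x, hne, hbb, rfl⟩
    have := Finset.card_le_univ ({t (g x), b, b'} : Finset B)
    omega
  have hsum := Finset.card_eq_sum_card_fiberwise (s := (Finset.univ : Finset A)) (f := t)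
    (t := Finset.univ) fun _ _ => Finset.mem_coe.2 (Finset.mem_univ _)
  rw [Finset.sum_congr rfl fun b' _ => le_antisymm (hle b' b) (hle b b'), Finset.sum_const,
    Finset.card_univ, Finset.card_univ, smul_eq_mul] at hsum
  rw [hsum, mul_comm]

theorem revPerm_ne_one {n : ℕ} (hn : n = 2) : (Fin.revPerm : Equiv.Perm (Fin n)) ≠ 1 := by
  subst hn
  decide

theorem isSaturated_directedPart : IsSaturated directedPart := by
  classical
  intro k i hi σ τ
  have := Fintype.ofFinite directedPart
  have hn : (binary.shiftN k).shift.deg 0 = 2 := shiftN_deg k (fun _ => rfl) 1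
  have hrev : (Fin.revPerm : Equiv.Perm (Fin ((binary.shiftN k).shift.deg 0))) ≠ 1 :=
    revPerm_ne_one hn
  have hcard : Fintype.card (Equiv.Perm (Fin ((binary.shiftN k).shift.deg 0))) = 2 := by
    rw [Fintype.card_perm, Fintype.card_fin, hn]
    rfl
  have hroot : ∀ h : directedPart, rootPerm (spineSect k h.1) = 1 := fun h => by
    obtain ⟨e, he⟩ := exists_directedFlip_eq h.2
    rw [← he]
    exact (spineSect_directedFlip k e).1
  obtain ⟨e₀, he₀, hmem⟩ := exists_mem_directedPart k
  have key := card_fiber_mul_of_ne hcard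
    (fun h : directedPart => rootPerm (sect (spineSect k h.1) i))
    (fun h => (⟨directedFlip e₀, hmem⟩ : directedPart) * h) (mul_right_injective _)
    (fun h => by
      obtain ⟨e, he⟩ := exists_directedFlip_eq h.2
      change rootPerm (sect (spineSect k (directedFlip e₀ * h.1)) i) ≠ _
      rw [← he, directedFlip_mul, ((spineSect_directedFlip k _).2 i hi).2,
        ((spineSect_directedFlip k e).2 i hi).2, he₀]
      cases e k
      · simpa using hrev
      · simpa using hrev.symm) τ
  simp only [Nat.card_eq_fintype_card, Fintype.card_subtype, hroot]
  by_cases hσ : 1 = σ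
  · simp only [hσ, true_and, Finset.filter_true, Finset.card_univ]
    exact key
  · simp only [hσ, false_and, Finset.filter_false, Finset.card_empty, zero_mul]

theorem isSaturatedDirectedPair : IsSaturatedDirectedPair rootedPart directedPart where
  rooted := by
    rintro s (rfl | rfl)
    exacts [IsRooted.one, isRooted_a]
  directed h hh := by
    obtain ⟨e, rfl⟩ := exists_directedFlip_eq hh
    exact isDirected_directedFlip e
  saturated := isSaturated_directedPart

end Grigorchuk

theorem theorem7p3 (Λ : Type*) [Group Λ] [Finite Λ] [Nontrivial Λ] :
    (∀ (d : DegreeSeq), (∃ D : ℕ, ∀ k, d.deg k ≤ D) →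
      ∀ (S : Set (TreeAut d)) [Finite S] [Nonempty S] (H : Subgroup (TreeAut d)) [Finite H],
        IsSaturatedDirectedPair S H →
          PartiallyEntropyNoiseSensitive (switchWalk Λ S H)) ∧
    (IsSaturatedDirectedPair Grigorchuk.rootedPart Grigorchuk.directedPart ∧
      PartiallyEntropyNoiseSensitive
        (switchWalk Λ Grigorchuk.rootedPart Grigorchuk.directedPart)) := by
  refine ⟨fun d ⟨D, hD⟩ S _ _ H _ hSH => ?_, Grigorchuk.isSaturatedDirectedPair, ?_⟩
  · exact partiallyEntropyNoiseSensitive_switchWalk hSH hD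
  · exact partiallyEntropyNoiseSensitive_switchWalk Grigorchuk.isSaturatedDirectedPair (D := 2)
      fun _ => le_rfl
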